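/- **Definitions.** Let $\mathbb{R}[t^{1/\infty}]=\mathbb{R}[t_n\mid n\ge 1]/(t_{mn}^m-t_n\mid m,n\ge 1)$ be the ring of real Puiseux polynomials, with $t^{1/n}$ the class of $t_n$; each element defines a function on $\mathbb{R}_{\ge 0}$ via nonnegative real $n$-th roots. For an infinite set $\mathcal{P}$ of positive integers and integers $(A_n)_{n\in\mathcal{P}}$, the *ceiling* (resp. *floor*) *Puiseux polynomial* of $(A_n)$ is the (unique, if it exists) $f\in\mathbb{R}[t^{1/\infty}]$ such that (1) $f(n)\ge A_n$ (resp. $f(n)\le A_n$) for all $n\in\mathcal{P}$; (2) $\lfloor f(n)\rfloor=A_n$ (resp. $\lceil f(n)\rceil=A_n$) for infinitely many $n\in\mathcal{P}$; (3) $f(1)\in\mathbb{Z}$. For a separated scheme $X$ of finite type over $\mathbb{Q}$, the *prime ceiling* (resp. *prime floor*) *Puiseux polynomial* $\mathfrak{C}'_X$ (resp. $\mathfrak{F}'_X$) is the $f$, if a unique one exists, with the following property: for every separated scheme $\mathcal{X}$ of finite type over $\mathbb{Z}$ with $\mathcal{X}_{\mathbb{Q}}\cong X$ there is a finite set $S_{\mathcal{X}}$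 of primes such that, for every finite set of primes $S'\supseteq S_{\mathcal{X}}$, $f$ is the ceiling (resp. floor) Puiseux polynomial of $(\#\mathcal{X}(\mathbb{F}_p))_p$, where $p$ runs over the primes not in $S'$. The *ceiling* (resp. *floor*) *Puiseux polynomial* $\mathfrak{C}_X$ (resp. $\mathfrak{F}_X$) is defined in the same way with the sequence $(\#\mathcal{X}(\mathbb{F}_q))_q$, where $q$ runs over all powers $p^m$, $m\ge 1$, of primes $p\notin S'$. **Statement.** Let $E$ be an elliptic curve over $\mathbb{Q}$, $S$ a finite set of primes, and $\mathcal{E}$ an elliptic curve over $\mathbb{Z}[S^{-1}]$ with $\mathcal{E}_{\mathbb{Q}}\cong E$. Call a prime $p\notin S$ a *champion* prime if $\#\mathcal{E}(\mathbb{F}_p)=p+1+\lfloor 2\sqrt{p}\rfloor$, and a *trailing* prime if $\#\mathcal{E}(\mathbb{F}_p)=p+1-\lfloor 2\sqrt{p}\rfloor$. 1. If there are infinitely many champion primes, then $\mathfrak{C}'_E$ and $\mathfrak{C}_E$ exist and $\mathfrak{C}'_E=\mathfrak{C}_E=t+2t^{1/2}+1$. 2. If there are infinitely many trailing primes, then $\mathfrak{F}'_E$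 and $\mathfrak{F}_E$ exist and $\mathfrak{F}'_E=\mathfrak{F}_E=t-2t^{1/2}+1$. -/

import Mathlib

open AlgebraicGeometry CategoryTheory
open scoped NNReal

/-! ### Puiseux polynomials -/

/-- The ideal generated by the relations `t_{mn} ^ m = t_n` (`m, n` positive integers) in the
polynomial ring over `R` in the indeterminates `t_n`. -/
noncomputable def puiseuxIdeal (R : Type*) [CommRing R] : Ideal (MvPolynomial ℕ+ R) :=
  Ideal.span {P | ∃ m n : ℕ+, P = MvPolynomial.X (m * n) ^ (m : ℕ) - MvPolynomial.X n}

/-- The ring `R[t^{1/∞}]` of Puiseux polynomials with coefficients in `R`. -/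
abbrev Puiseux (R : Type*) [CommRing R] : Type _ :=
  MvPolynomial ℕ+ R ⧸ puiseuxIdeal R

namespace Puiseux

/-- The element `t^{1/n}` of `R[t^{1/∞}]`. -/
noncomputable def root (R : Type*) [CommRing R] (n : ℕ+) : Puiseux R :=
  Ideal.Quotient.mk (puiseuxIdeal R) (MvPolynomial.X n)

theorem eval_aux (x : ℝ≥0) (P : MvPolynomial ℕ+ ℝ) (hP : P ∈ puiseuxIdeal ℝ) :
    MvPolynomial.eval (fun n : ℕ+ => (x : ℝ) ^ (1 / (n : ℝ))) P = 0 := by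
  have hle : puiseuxIdeal ℝ ≤
      RingHom.ker (MvPolynomial.eval (fun n : ℕ+ => (x : ℝ) ^ (1 / (n : ℝ)))) := by
    refine Ideal.span_le.mpr ?_
    rintro _ ⟨m, n, rfl⟩
    have hm : (m : ℝ) ≠ 0 := by exact_mod_cast m.ne_zero
    have h : ((x : ℝ) ^ (1 / ((m * n : ℕ+) : ℝ))) ^ (m : ℕ) = (x : ℝ) ^ (1 / (n : ℝ)) := by
      rw [← Real.rpow_mul_natCast x.coe_nonneg, PNat.mul_coe]
      congr 1
      push_cast
      field_simp
    simp only [SetLike.mem_coe, RingHom.mem_ker, map_sub, map_pow, MvPolynomial.eval_X]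
    rw [sub_eq_zero]
    exact h
  exact RingHom.mem_ker.mp (hle hP)

/-- The value at `x ≥ 0` of a real Puiseux polynomial: `t^{1/n}` is sent to the nonnegative real
`n`-th root of `x`. -/
noncomputable def eval (x : ℝ≥0) : Puiseux ℝ →+* ℝ :=
  Ideal.Quotient.lift (puiseuxIdeal ℝ)
    (MvPolynomial.eval (fun n : ℕ+ => (x : ℝ) ^ (1 / (n : ℝ)))) (eval_aux x)

end Puiseux

/-- `f` is the ceiling Puiseux polynomial of the integer sequence `(A n)_{n ∈ P}`. -/
structure IsCeilingPuiseux (P : Set ℕ) (A : ℕ → ℤ) (f : Puiseux ℝ) : Prop where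
  le_eval : ∀ n ∈ P, (A n : ℝ) ≤ Puiseux.eval n f
  infinite_floor_eq : {n ∈ P | ⌊Puiseux.eval n f⌋ = A n}.Infinite
  eval_one : ∃ k : ℤ, Puiseux.eval 1 f = k

/-- `f` is the floor Puiseux polynomial of the integer sequence `(A n)_{n ∈ P}`. -/
structure IsFloorPuiseux (P : Set ℕ) (A : ℕ → ℤ) (f : Puiseux ℝ) : Prop where
  eval_le : ∀ n ∈ P, Puiseux.eval n f ≤ (A n : ℝ)
  infinite_ceil_eq : {n ∈ P | ⌈Puiseux.eval n f⌉ = A n}.Infinite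
  eval_one : ∃ k : ℤ, Puiseux.eval 1 f = k

/-! ### Points over finite fields and models -/

/-- The number `#𝒳(𝔽_q)` of `𝔽_q`-rational points of a scheme, for a prime power `q`
(and `0` for every other `q`). -/
noncomputable def pointCount (𝒳 : Scheme.{0}) (q : ℕ) : ℕ :=
  open Classical in
  if h : IsPrimePow q then
    haveI : Fact q.minFac.Prime := ⟨Nat.minFac_prime h.ne_one⟩
    Nat.card (Spec (.of (GaloisField q.minFac (q.factorization q.minFac))) ⟶ 𝒳)
  else 0

/-- The choice of the field with `q` elements in `pointCount` does not matter. -/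
theorem pointCount_eq (𝒳 : Scheme.{0}) (F : Type) [Field F] [Finite F] :
    pointCount 𝒳 (Nat.card F) = Nat.card (Spec (.of F) ⟶ 𝒳) := by
  have h : IsPrimePow (Nat.card F) := by
    have := Fintype.ofFinite F
    rw [Nat.card_eq_fintype_card]
    exact FiniteField.isPrimePow_card F
  have : Fact (Nat.card F).minFac.Prime := ⟨Nat.minFac_prime h.ne_one⟩
  set p := (Nat.card F).minFac with hp
  set m := (Nat.card F).factorization p with hm
  have hq : p ^ m = Nat.card F := h.minFac_pow_factorization_eq
  have hm0 : m ≠ 0 := by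
    intro h0
    rw [h0, pow_zero] at hq
    exact h.ne_one hq.symm
  have := Fintype.ofFinite F
  have := Fintype.ofFinite (GaloisField p m)
  have hcard : Fintype.card (GaloisField p m) = Fintype.card F := by
    rw [← Nat.card_eq_fintype_card, ← Nat.card_eq_fintype_card, GaloisField.card p m hm0, hq]
  let e : GaloisField p m ≃+* F := FiniteField.ringEquivOfCardEq hcard
  let i : Spec (.of F) ≅ Spec (.of (GaloisField p m)) := Scheme.Spec.mapIso e.toCommRingCatIso.op
  rw [pointCount, dif_pos h]
  exact Nat.card_congr (i.homCongr (Iso.refl 𝒳)).symm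

/-- `X` (with structure morphism `s` to `Spec ℚ`) is isomorphic over `ℚ` to the base change
`𝒳_ℚ` of the `R`-scheme `𝒳` (with structure morphism `π`). -/
def IsGenericFiber {R : Type} [CommRing R] [Algebra R ℚ] {𝒳 X : Scheme.{0}}
    (π : 𝒳 ⟶ Spec (.of R)) (s : X ⟶ Spec (.of ℚ)) : Prop :=
  ∃ e : Limits.pullback π (Spec.map (CommRingCat.ofHom (algebraMap R ℚ))) ≅ X,
    e.hom ≫ s = Limits.pullback.snd π (Spec.map (CommRingCat.ofHom (algebraMap R ℚ)))

/-- The primes outside `S`. -/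
def primesAway (S : Finset Nat.Primes) : Set ℕ :=
  {n | ∃ p : Nat.Primes, p ∉ S ∧ n = p}

/-- The powers `p ^ m`, `m ≥ 1`, of the primes `p` outside `S`. -/
def primePowersAway (S : Finset Nat.Primes) : Set ℕ :=
  {n | ∃ p : Nat.Primes, p ∉ S ∧ ∃ m : ℕ, 1 ≤ m ∧ n = (p : ℕ) ^ m}

/-! In the next four definitions `X` is a (separated) scheme (of finite type) over `ℚ` with
structure morphism `s`. Separated schemes of finite type over `ℤ` are those for which the
structure morphism is separated, locally of finite type and quasi-compact. -/

/-- `f` is the ceiling Puiseux polynomial `ℭ_X` of `X`. -/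
def IsCeilingPuiseuxOf {X : Scheme.{0}} (s : X ⟶ Spec (.of ℚ)) (f : Puiseux ℝ) : Prop :=
  ∀ (𝒳 : Scheme.{0}) (π : 𝒳 ⟶ Spec (.of ℤ)) [IsSeparated π] [LocallyOfFiniteType π]
    [QuasiCompact π], IsGenericFiber π s →
      ∃ S₀ : Finset Nat.Primes, ∀ S : Finset Nat.Primes, S₀ ⊆ S →
        IsCeilingPuiseux (primePowersAway S) (fun q => pointCount 𝒳 q) f

/-- `f` is the floor Puiseux polynomial `𝔉_X` of `X`. -/
def IsFloorPuiseuxOf {X : Scheme.{0}} (s : X ⟶ Spec (.of ℚ)) (f : Puiseux ℝ) : Prop :=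
  ∀ (𝒳 : Scheme.{0}) (π : 𝒳 ⟶ Spec (.of ℤ)) [IsSeparated π] [LocallyOfFiniteType π]
    [QuasiCompact π], IsGenericFiber π s →
      ∃ S₀ : Finset Nat.Primes, ∀ S : Finset Nat.Primes, S₀ ⊆ S →
        IsFloorPuiseux (primePowersAway S) (fun q => pointCount 𝒳 q) f

/-- `f` is the prime ceiling Puiseux polynomial `ℭ'_X` of `X`. -/
def IsPrimeCeilingPuiseuxOf {X : Scheme.{0}} (s : X ⟶ Spec (.of ℚ)) (f : Puiseux ℝ) : Prop :=
  ∀ (𝒳 : Scheme.{0}) (π : 𝒳 ⟶ Spec (.of ℤ)) [IsSeparated π] [LocallyOfFiniteType π]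
    [QuasiCompact π], IsGenericFiber π s →
      ∃ S₀ : Finset Nat.Primes, ∀ S : Finset Nat.Primes, S₀ ⊆ S →
        IsCeilingPuiseux (primesAway S) (fun p => pointCount 𝒳 p) f

/-- `f` is the prime floor Puiseux polynomial `𝔉'_X` of `X`. -/
def IsPrimeFloorPuiseuxOf {X : Scheme.{0}} (s : X ⟶ Spec (.of ℚ)) (f : Puiseux ℝ) : Prop :=
  ∀ (𝒳 : Scheme.{0}) (π : 𝒳 ⟶ Spec (.of ℤ)) [IsSeparated π] [LocallyOfFiniteType π]
    [QuasiCompact π], IsGenericFiber π s →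
      ∃ S₀ : Finset Nat.Primes, ∀ S : Finset Nat.Primes, S₀ ⊆ S →
        IsFloorPuiseux (primesAway S) (fun p => pointCount 𝒳 p) f

/-! ### The projective scheme of a Weierstrass curve -/

namespace WeierstrassCurve

section Scheme

variable {R : Type} [CommRing R] (W : WeierstrassCurve R)

attribute [local instance] MvPolynomial.gradedAlgebra

/-- The homogeneous coordinate ring `R[X, Y, Z] / (F)`, where `F` is the homogeneous Weierstrass
cubic of `W`. -/
abbrev HomogCoordRing : Type :=
  MvPolynomial (Fin 3) R ⧸ Ideal.span {W.toProjective.polynomial}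

/-- The degree `n` part of the homogeneous coordinate ring. -/
noncomputable def homogCoordGrading (n : ℕ) : Submodule R W.HomogCoordRing :=
  (MvPolynomial.homogeneousSubmodule (Fin 3) R n).map
    (Ideal.Quotient.mkₐ R (Ideal.span {W.toProjective.polynomial})).toLinearMap

theorem mk_mem_homogCoordGrading {n : ℕ} {P : MvPolynomial (Fin 3) R} (hP : P.IsHomogeneous n) :
    Ideal.Quotient.mkₐ R (Ideal.span {W.toProjective.polynomial}) P ∈ W.homogCoordGrading n :=
  Submodule.mem_map_of_mem (f := (Ideal.Quotient.mkₐ R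
    (Ideal.span {W.toProjective.polynomial})).toLinearMap)
    ((MvPolynomial.mem_homogeneousSubmodule n P).mpr hP)

theorem isHomogeneous_projective_polynomial : W.toProjective.polynomial.IsHomogeneous 3 := by
  have hX (i : Fin 3) : (MvPolynomial.X i : MvPolynomial (Fin 3) R).IsHomogeneous 1 :=
    MvPolynomial.isHomogeneous_X R i
  have hC (c : R) : (MvPolynomial.C c : MvPolynomial (Fin 3) R).IsHomogeneous 0 :=
    MvPolynomial.isHomogeneous_C (Fin 3) c
  exact (((((hX 1).pow 2).mul (hX 2)).add ((((hC _).mul (hX 0)).mul (hX 1)).mul (hX 2))).add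
    (((hC _).mul (hX 1)).mul ((hX 2).pow 2))).sub
    (((((hX 0).pow 3).add (((hC _).mul ((hX 0).pow 2)).mul (hX 2))).add
    (((hC _).mul (hX 0)).mul ((hX 2).pow 2))).add ((hC _).mul ((hX 2).pow 3)))

instance homogCoordGrading_gradedMonoid : SetLike.GradedMonoid W.homogCoordGrading where
  one_mem := by
    rw [← map_one (Ideal.Quotient.mkₐ R (Ideal.span {W.toProjective.polynomial}))]
    exact W.mk_mem_homogCoordGrading (MvPolynomial.isHomogeneous_one (Fin 3) R)
  mul_mem := by
    rintro i j _ _ ⟨P, hP, rfl⟩ ⟨Q, hQ, rfl⟩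
    have h := W.mk_mem_homogCoordGrading (MvPolynomial.IsHomogeneous.mul
      ((MvPolynomial.mem_homogeneousSubmodule i P).mp hP)
      ((MvPolynomial.mem_homogeneousSubmodule j Q).mp hQ))
    rw [map_mul] at h
    exact h

open scoped DirectSum in
/-- The map induced by the quotient map on the direct sums of the graded pieces. -/
noncomputable def homogCoordSumMap :
    (⨁ n, MvPolynomial.homogeneousSubmodule (Fin 3) R n) →ₐ[R] ⨁ n, W.homogCoordGrading n :=
  DirectSum.toAlgebra R (fun n => MvPolynomial.homogeneousSubmodule (Fin 3) R n)
    (fun n => (DirectSum.lof R ℕ (fun n => W.homogCoordGrading n) n).comp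
      ((Ideal.Quotient.mkₐ R (Ideal.span {W.toProjective.polynomial})).toLinearMap.restrict
        (fun _ hP => Submodule.mem_map_of_mem hP)))
    rfl
    (by
      intro i j P Q
      simp only [LinearMap.comp_apply, DirectSum.lof_eq_of]
      rw [DirectSum.of_mul_of]
      congr 1)

theorem homogCoordSumMap_of (n : ℕ) (P : MvPolynomial.homogeneousSubmodule (Fin 3) R n) :
    W.homogCoordSumMap
      (DirectSum.of (fun n => MvPolynomial.homogeneousSubmodule (Fin 3) R n) n P) =
      DirectSum.of (fun n => W.homogCoordGrading n) n
        ⟨_, W.mk_mem_homogCoordGrading ((MvPolynomial.mem_homogeneousSubmodule n _).mp P.2)⟩ :=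
  DirectSum.toAddMonoid_of _ _ _

open scoped DirectSum in
/-- The algebra homomorphism from `R[X, Y, Z]` to the direct sum of the graded pieces of the
homogeneous coordinate ring. -/
noncomputable def homogCoordDecomposeAux :
    MvPolynomial (Fin 3) R →ₐ[R] ⨁ n, W.homogCoordGrading n :=
  W.homogCoordSumMap.comp
    (DirectSum.decomposeAlgEquiv (MvPolynomial.homogeneousSubmodule (Fin 3) R)).toAlgHom

theorem homogCoordDecomposeAux_apply {n : ℕ} {P : MvPolynomial (Fin 3) R}
    (hP : P.IsHomogeneous n) :
    W.homogCoordDecomposeAux P =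
      DirectSum.of (fun n => W.homogCoordGrading n) n ⟨_, W.mk_mem_homogCoordGrading hP⟩ := by
  have h : DirectSum.decompose (MvPolynomial.homogeneousSubmodule (Fin 3) R) P =
      DirectSum.of (fun n => MvPolynomial.homogeneousSubmodule (Fin 3) R n) n
        ⟨P, (MvPolynomial.mem_homogeneousSubmodule n P).mpr hP⟩ :=
    DirectSum.decompose_of_mem _ ((MvPolynomial.mem_homogeneousSubmodule n P).mpr hP)
  exact (congrArg W.homogCoordSumMap h).trans (W.homogCoordSumMap_of n _)

theorem homogCoordDecomposeAux_eq_zero (P : MvPolynomial (Fin 3) R)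
    (hP : P ∈ Ideal.span {W.toProjective.polynomial}) : W.homogCoordDecomposeAux P = 0 := by
  have hle : Ideal.span {W.toProjective.polynomial} ≤
      RingHom.ker W.homogCoordDecomposeAux.toRingHom := by
    rw [Ideal.span_singleton_le_iff_mem, RingHom.mem_ker]
    change W.homogCoordDecomposeAux _ = 0
    rw [W.homogCoordDecomposeAux_apply W.isHomogeneous_projective_polynomial]
    have h0 : (⟨_, W.mk_mem_homogCoordGrading W.isHomogeneous_projective_polynomial⟩ :
        W.homogCoordGrading 3) = 0 := by
      apply Subtype.ext
      exact Ideal.Quotient.eq_zero_iff_mem.mpr (Ideal.mem_span_singleton_self _)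
    rw [h0, map_zero]
  exact RingHom.mem_ker.mp (hle hP)

noncomputable instance homogCoordGrading_gradedAlgebra : GradedAlgebra W.homogCoordGrading :=
  GradedAlgebra.ofAlgHom W.homogCoordGrading
    (Ideal.Quotient.liftₐ (Ideal.span {W.toProjective.polynomial}) W.homogCoordDecomposeAux
      W.homogCoordDecomposeAux_eq_zero)
    (by
      apply Ideal.Quotient.algHom_ext
      apply MvPolynomial.algHom_ext
      intro i
      change DirectSum.coeAlgHom W.homogCoordGrading
        (W.homogCoordDecomposeAux (MvPolynomial.X i)) = _
      rw [W.homogCoordDecomposeAux_apply (MvPolynomial.isHomogeneous_X R i),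
        DirectSum.coeAlgHom_of]
      rfl)
    (by
      rintro n ⟨_, P, hP, rfl⟩
      exact W.homogCoordDecomposeAux_apply ((MvPolynomial.mem_homogeneousSubmodule n P).mp hP))

/-- The projective scheme `Proj R[X, Y, Z] / (F)` over `R` defined by the Weierstrass equation. -/
noncomputable def projScheme : Scheme.{0} :=
  Proj W.homogCoordGrading

/-- The structure morphism of `W.projScheme`. -/
noncomputable def projSchemeToSpec : W.projScheme ⟶ Spec (.of R) :=
  Proj.toSpecZero W.homogCoordGrading ≫
    Spec.map (CommRingCat.ofHom (algebraMap R (W.homogCoordGrading 0)))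

end Scheme

end WeierstrassCurve

/-! ### Champion and trailing primes -/

/-- The ring `ℤ[S⁻¹]`, as a subring of `ℚ`. -/
abbrev ZInv (S : Finset Nat.Primes) : Subalgebra ℤ ℚ :=
  Algebra.adjoin ℤ ((fun p : Nat.Primes => ((p : ℕ) : ℚ)⁻¹) '' S)

/-- The champion primes of a scheme `𝓔` over `ℤ[S⁻¹]`. -/
def championPrimes (S : Finset Nat.Primes) (𝓔 : Scheme.{0}) : Set Nat.Primes :=
  {p | p ∉ S ∧ (pointCount 𝓔 p : ℤ) = p + 1 + ⌊2 * √(p : ℝ)⌋}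

/-- The trailing primes of a scheme `𝓔` over `ℤ[S⁻¹]`. -/
def trailingPrimes (S : Finset Nat.Primes) (𝓔 : Scheme.{0}) : Set Nat.Primes :=
  {p | p ∉ S ∧ (pointCount 𝓔 p : ℤ) = p + 1 - ⌊2 * √(p : ℝ)⌋}

/-! ### The addition-and-subtraction map on `x`-coordinates -/

namespace WeierstrassCurve

variable {R : Type*} [CommRing R] (W : WeierstrassCurve R)

/-! Everything rests on Hasse's bound `|#𝒳(𝔽_q) - q - 1| ≤ 2√q`, valid for any model `𝒳` of `E` at
all powers of almost all primes. It says that `t + 2t^{1/2} + 1` dominates the counts and `t -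
2t^{1/2} + 1` is dominated by them. At a champion prime the integer part of `p + 2√p + 1` is exactly
the count; at a trailing prime the same holds with the ceiling. The values at `1` are the integers
`4` and `0`. Uniqueness is formal (`IsCeilingPuiseux.unique`): the difference of two candidates is a
polynomial in some `t^{1/n}` that is infinitely often `< 1` and infinitely often `> -1`, so it is a
constant of absolute value `< 1`, and it is an integer at `1`.

Hasse's bound is proved by Manin's elementary method. For `y² = f(x)` over a field `F` with `q`
elements, `q` odd, the points of the twist `f(t) y² = f(x)` over `F(t)` correspond to morphisms from
the curve to itself, and the height of the `x`-coordinate plays the role of the degree. The map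
`(x(P), x(Q)) ↦ (x(P + Q), x(P - Q))` is given by quadratic forms with coefficients in `F` and no
common zero, so heights satisfy the exact parallelogram law (`HasTwistHeight.parallelogram`). The
Frobenius point has height `q`, the identity point has height `1`, and their difference has height
`N + 1` with `N` the number of affine points, by counting what cancels in its `x`-coordinate
(`exists_frobenius_factorization`). Nonnegativity of heights is then a discriminant inequality
(`HasTwistHeight.sq_le`).

Two further ingredients make this apply to every model. `ℚ` is the filtered colimit of the rings
`ℤ[S⁻¹]`, so two models of `E` have the same points over all finite fields outside finitely many
characteristics (`SpreadOut.nonempty_equiv_specPoints`). And `Proj` commutes with localization of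
the base, so an integral Weierstrass equation of `E` defines one model, whose points are the affine
solutions and one point at infinity (`card_points`). -/

theorem eval_addSubMap_zero (x : Fin 3 → R) : (W.addSubMap 0).eval x =
    x 0 ^ 2 - W.b₄ * x 0 * x 2 - W.b₆ * x 1 * x 2 - W.b₈ * x 2 ^ 2 := by
  simp [addSubMap]

theorem eval_addSubMap_one (x : Fin 3 → R) : (W.addSubMap 1).eval x =
    2 * x 1 * x 0 + W.b₂ * x 0 * x 2 + W.b₄ * x 1 * x 2 + W.b₆ * x 2 ^ 2 := by
  simp [addSubMap]

theorem eval_addSubMap_two (x : Fin 3 → R) :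
    (W.addSubMap 2).eval x = x 1 ^ 2 - 4 * x 0 * x 2 := by
  simp [addSubMap]

namespace Affine.Point

variable {K : Type*} [Field K] [DecidableEq K] {W : Affine K}

theorem smul_sym2x_add_sub_of_X_ne (h₁ : W.a₁ = 0) (h₃ : W.a₃ = 0) {x₁ y₁ x₂ y₂ : K}
    (hP : W.Nonsingular x₁ y₁) (hQ : W.Nonsingular x₂ y₂) (hx : x₁ ≠ x₂) (i : Fin 3) :
    (W.addSubMap i).eval ((some x₁ y₁ hP).sym2x (some x₂ y₂ hQ)) =
      (x₁ - x₂) ^ 2 * (some x₁ y₁ hP + some x₂ y₂ hQ).sym2x (some x₁ y₁ hP - some x₂ y₂ hQ) i := by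
  have hx' : x₁ - x₂ ≠ 0 := sub_ne_zero.mpr hx
  have e₁ := (equation_iff ..).mp hP.1
  have e₂ := (equation_iff ..).mp hQ.1
  rw [h₁, h₃] at e₁ e₂
  rw [sub_eq_add_neg (some x₁ y₁ hP), neg_some, add_of_X_ne hx, add_of_X_ne hx, sym2x_some_some,
    sym2x_some_some]
  simp only [slope_of_X_ne hx, addX, negY, h₁, h₃]
  fin_cases i
  · simp only [Fin.zero_eta, eval_addSubMap_zero, b₄, b₆, b₈, h₁, h₃]
    simp
    field_simp
    have e₁' : y₁ ^ 2 = x₁ ^ 3 + W.a₂ * x₁ ^ 2 + W.a₄ * x₁ + W.a₆ := by linear_combination e₁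
    have e₂' : y₂ ^ 2 = x₂ ^ 3 + W.a₂ * x₂ ^ 2 + W.a₄ * x₂ + W.a₆ := by linear_combination e₂
    -- The product of the two `x`-coordinates involves `y₁⁴` and `y₂⁴`, which rewriting `y²` does
    -- not reach after normalization.
    have k₁ : y₁ ^ 4 = (x₁ ^ 3 + W.a₂ * x₁ ^ 2 + W.a₄ * x₁ + W.a₆) ^ 2 := by rw [← e₁']; ring
    have k₂ : y₂ ^ 4 = (x₂ ^ 3 + W.a₂ * x₂ ^ 2 + W.a₄ * x₂ + W.a₆) ^ 2 := by rw [← e₂']; ring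
    ring_nf
    simp only [k₁, k₂, e₁', e₂']
    ring
  · simp only [Fin.mk_one, eval_addSubMap_one, b₂, b₄, b₆, h₁, h₃]
    simp
    field_simp
    linear_combination (-2) * e₁ + (-2) * e₂
  · simp only [Fin.reduceFinMk, eval_addSubMap_two]
    simp
    ring

/-- On the diagonal the map becomes the duplication formula, whose denominator is `4f(x) = (2y)²`.
It vanishes exactly at the points of order two, where the image is the class of the point at
infinity. -/
theorem exists_smul_sym2x_add_self (h₁ : W.a₁ = 0) (h₃ : W.a₃ = 0) {x y : K}
    (hP : W.Nonsingular x y) :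
    ∃ c : K, ∀ i, (W.addSubMap i).eval ((some x y hP).sym2x (some x y hP)) =
      c * (some x y hP + some x y hP).sym2x 0 i := by
  have e := (equation_iff ..).mp hP.1
  rw [h₁, h₃] at e
  rw [sym2x_some_some]
  by_cases hy : y = W.negY x y
  · rw [add_self_of_Y_eq hy, sym2x_zero_zero]
    have hy2 : 2 * y = 0 := by
      simp only [negY, h₁, h₃] at hy
      linear_combination hy
    refine ⟨(W.addSubMap 0).eval ![x * x, x + x, 1], fun i ↦ ?_⟩
    fin_cases i
    · simp
    · simp only [Fin.mk_one, eval_addSubMap_one, b₂, b₄, b₆, h₁, h₃]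
      simp
      linear_combination (-4) * e + (2 * y) * hy2
    · simp only [Fin.reduceFinMk, eval_addSubMap_two]
      simp
      ring
  · have hy2 : 2 * y ≠ 0 := by
      simp only [negY, h₁, h₃] at hy
      contrapose! hy
      linear_combination hy
    have h2 : (2 : K) ≠ 0 := left_ne_zero_of_mul hy2
    have hy0 : y ≠ 0 := right_ne_zero_of_mul hy2
    rw [add_self_of_Y_ne hy, sym2x_some_zero, slope_of_Y_ne rfl hy]
    simp only [negY, addX, h₁, h₃]
    have e' : y ^ 2 = x ^ 3 + W.a₂ * x ^ 2 + W.a₄ * x + W.a₆ := by linear_combination e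
    have hyy : y - (-y - 0 * x - 0) = 2 * y := by ring
    refine ⟨(2 * y) ^ 2, fun i ↦ ?_⟩
    fin_cases i
    · simp only [Fin.zero_eta, eval_addSubMap_zero, b₄, b₆, b₈, h₁, h₃, hyy]
      simp
      field_simp
      rw [e']
      ring
    · simp only [Fin.mk_one, eval_addSubMap_one, b₂, b₄, b₆, h₁, h₃]
      simp
      linear_combination (-4) * e
    · simp only [Fin.reduceFinMk, eval_addSubMap_two]
      simp
      ring

/-- The addition-and-subtraction map sends the class of `(x(P), x(Q))` to that of
`(x(P + Q), x(P - Q))`. -/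
theorem exists_eval_addSubMap_sym2x (h₁ : W.a₁ = 0) (h₃ : W.a₃ = 0) (P Q : W.Point) :
    ∃ c : K, ∀ i, (W.addSubMap i).eval (P.sym2x Q) = c * (P + Q).sym2x (P - Q) i := by
  match P, Q with
  | 0, Q =>
    refine ⟨1, fun i ↦ ?_⟩
    rw [zero_add, zero_sub, sym2x_neg_right, one_mul]
    match Q with
    | 0 => fin_cases i <;>
        simp [eval_addSubMap_zero, eval_addSubMap_one, eval_addSubMap_two]
    | some x y h => fin_cases i <;>
        simp [eval_addSubMap_zero, eval_addSubMap_one, eval_addSubMap_two] <;> ring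
  | some x y h, 0 =>
    refine ⟨1, fun i ↦ ?_⟩
    rw [add_zero, sub_zero, one_mul]
    fin_cases i <;>
      simp [eval_addSubMap_zero, eval_addSubMap_one, eval_addSubMap_two] <;> ring
  | some x₁ y₁ hP, some x₂ y₂ hQ =>
    by_cases hx : x₁ = x₂
    · rcases X_eq_iff.mp hx with h | h
      · rw [h, sub_self]
        exact exists_smul_sym2x_add_self h₁ h₃ hQ
      · rw [h, neg_add_cancel, sym2x_neg_left, ← neg_add', sym2x_neg_right, sym2x_comm 0]
        exact exists_smul_sym2x_add_self h₁ h₃ hQ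
    · exact ⟨_, smul_sym2x_add_sub_of_X_ne h₁ h₃ hP hQ hx⟩

end Affine.Point
end WeierstrassCurve

/-! ### Heights of primitive vectors of polynomials -/

/-- The vector `v` of polynomials is primitive and `d` is the maximal degree of its entries. -/
structure HasPolyHeight {F : Type*} [Field F] {ι : Type*} (v : ι → Polynomial F) (d : ℕ) :
    Prop where
  span_eq_top : Ideal.span (Set.range v) = ⊤
  natDegree_le : ∀ i, (v i).natDegree ≤ d
  exists_coeff_ne_zero : ∃ i, (v i).coeff d ≠ 0

namespace HasPolyHeight

open Polynomial

variable {F : Type*} [Field F] {ι : Type*}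

theorem exists_of_span_eq_top [Finite ι] {v : ι → F[X]} (hv : Ideal.span (Set.range v) = ⊤) :
    ∃ d, HasPolyHeight v d := by
  obtain ⟨j, hj⟩ : ∃ j, v j ≠ 0 := by
    by_contra! h
    rw [Ideal.span_eq_bot.mpr (by rintro _ ⟨j, rfl⟩; exact h j)] at hv
    exact bot_ne_top hv
  have : Nonempty ι := ⟨j⟩
  obtain ⟨i, hi⟩ := Finite.exists_max (fun i ↦ (v i).degree)
  have hi0 : v i ≠ 0 := by
    intro h
    have := hi j
    rw [h, degree_zero, le_bot_iff, degree_eq_bot] at this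
    exact hj this
  exact ⟨_, hv, fun k ↦ natDegree_le_natDegree (hi k), i, leadingCoeff_ne_zero.mpr hi0⟩

/-- Multiply a Bézout relation `∑ cᵢ vᵢ = 1` by `wⱼ` and use proportionality: `wⱼ = vⱼ ∑ cᵢ wᵢ`. -/
theorem dvd_of_cross [Finite ι] {v w : ι → F[X]} (hv : Ideal.span (Set.range v) = ⊤)
    (h : ∀ i j, v i * w j = v j * w i) (j : ι) : v j ∣ w j := by
  have : Fintype ι := Fintype.ofFinite ι
  obtain ⟨c, hc⟩ := (Ideal.mem_span_range_iff_exists_fun).mp (hv ▸ Submodule.mem_top : (1 : F[X]) ∈ _)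
  refine ⟨∑ i, c i * w i, ?_⟩
  calc w j = (∑ i, c i * v i) * w j := by rw [hc, one_mul]
    _ = v j * ∑ i, c i * w i := by
      rw [Finset.sum_mul, Finset.mul_sum]
      exact Finset.sum_congr rfl fun i _ ↦ by linear_combination c i * h i j

theorem natDegree_eq_of_cross [Finite ι] {v w : ι → F[X]} (hv : Ideal.span (Set.range v) = ⊤)
    (hw : Ideal.span (Set.range w) = ⊤) (h : ∀ i j, v i * w j = v j * w i) (j : ι) :
    (v j).natDegree = (w j).natDegree :=
  natDegree_eq_of_degree_eq (degree_eq_degree_of_associated (associated_of_dvd_dvd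
    (dvd_of_cross hv h j) (dvd_of_cross hw (fun i j ↦ by linear_combination -h i j) j)))

theorem le_of_forall_natDegree_le {v w : ι → F[X]} {d e : ℕ} (hv : HasPolyHeight v d)
    (hw : HasPolyHeight w e) (h : ∀ i, (v i).natDegree ≤ (w i).natDegree) : d ≤ e := by
  obtain ⟨i, hi⟩ := hv.exists_coeff_ne_zero
  exact (le_natDegree_of_ne_zero hi).trans ((h i).trans (hw.natDegree_le i))

/-- Proportional primitive vectors have the same height. -/
theorem eq_of_cross [Finite ι] {v w : ι → F[X]} {d e : ℕ} (hv : HasPolyHeight v d)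
    (hw : HasPolyHeight w e) (h : ∀ i j, v i * w j = v j * w i) : d = e :=
  have H := natDegree_eq_of_cross hv.span_eq_top hw.span_eq_top h
  le_antisymm (le_of_forall_natDegree_le hv hw fun i ↦ (H i).le)
    (le_of_forall_natDegree_le hw hv fun i ↦ (H i).ge)

/-- Primitivity is nonvanishing in every residue field, which reduces statements about primitive
vectors to statements over fields. -/
theorem span_eq_top_iff {v : ι → F[X]} : Ideal.span (Set.range v) = ⊤ ↔
    ∀ M : Ideal F[X], M.IsMaximal → ∃ i, v i ∉ M := by
  refine ⟨fun h M hM ↦ ?_, fun h ↦ ?_⟩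
  · by_contra! H
    exact hM.ne_top (top_le_iff.mp (h ▸ Ideal.span_le.mpr (by rintro _ ⟨i, rfl⟩; exact H i)))
  · by_contra H
    obtain ⟨M, hM, hle⟩ := Ideal.exists_le_maximal _ H
    obtain ⟨i, hi⟩ := h M hM
    exact hi (hle (Ideal.subset_span ⟨i, rfl⟩))

/-- The symmetric product of two vectors of length two. -/
def symProd {R : Type*} [CommRing R] (p q : Fin 2 → R) : Fin 3 → R :=
  ![p 0 * q 0, p 0 * q 1 + p 1 * q 0, p 1 * q 1]

/-- The entries are the coefficients of a product of two nonzero binary linear forms. It is applied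
both in residue fields and to top coefficients, that is, at infinity. -/
theorem symProd_ne_zero {R : Type*} [CommRing R] [IsDomain R] {p q : Fin 2 → R} (hp : p ≠ 0)
    (hq : q ≠ 0) : symProd p q ≠ 0 := by
  intro h
  have h0 : p 0 * q 0 = 0 := congrFun h 0
  have h1 : p 0 * q 1 + p 1 * q 0 = 0 := congrFun h 1
  have h2 : p 1 * q 1 = 0 := congrFun h 2
  have hp' : p 0 ≠ 0 ∨ p 1 ≠ 0 := by
    by_contra! H
    exact hp (by ext i; fin_cases i <;> simp [H])
  have hq' : q 0 ≠ 0 ∨ q 1 ≠ 0 := by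
    by_contra! H
    exact hq (by ext i; fin_cases i <;> simp [H])
  -- Both `p₀q₁` and `p₁q₀` have square zero, since their sum and their product vanish.
  have h3 : p 0 * q 1 = 0 := pow_eq_zero_iff two_ne_zero |>.mp (by
    linear_combination (p 0 * q 1) * h1 - (p 0 * q 0) * h2)
  have h4 : p 1 * q 0 = 0 := by rwa [h3, zero_add] at h1
  simp only [mul_eq_zero] at h0 h2 h3 h4
  tauto

theorem map_symProd {R S : Type*} [CommRing R] [CommRing S] (f : R →+* S) (p q : Fin 2 → R)
    (i : Fin 3) : f (symProd p q i) = symProd (f ∘ p) (f ∘ q) i := by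
  fin_cases i <;> simp [symProd]

theorem span_symProd {p q : Fin 2 → F[X]} (hp : Ideal.span (Set.range p) = ⊤)
    (hq : Ideal.span (Set.range q) = ⊤) : Ideal.span (Set.range (symProd p q)) = ⊤ := by
  rw [span_eq_top_iff] at hp hq ⊢
  intro M hM
  obtain ⟨i, hi⟩ := hp M hM
  obtain ⟨j, hj⟩ := hq M hM
  by_contra! H
  refine symProd_ne_zero (p := Ideal.Quotient.mk M ∘ p) (q := Ideal.Quotient.mk M ∘ q) ?_ ?_ ?_
  · exact fun h ↦ hi (Ideal.Quotient.eq_zero_iff_mem.mp (congrFun h i))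
  · exact fun h ↦ hj (Ideal.Quotient.eq_zero_iff_mem.mp (congrFun h j))
  · ext k
    rw [← map_symProd]
    exact Ideal.Quotient.eq_zero_iff_mem.mpr (H k)

/-- There is no cancellation at finite places (`span_symProd`), nor at infinity: the coefficients of
degree `d + e` form the symmetric product of the nonzero vectors of top coefficients. -/
theorem symProd_add {p q : Fin 2 → F[X]} {d e : ℕ} (hp : HasPolyHeight p d) (hq : HasPolyHeight q e) :
    HasPolyHeight (symProd p q) (d + e) where
  span_eq_top := span_symProd hp.span_eq_top hq.span_eq_top
  natDegree_le i := by
    have h (i j) : (p i * q j).natDegree ≤ d + e :=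
      natDegree_mul_le_of_le (hp.natDegree_le i) (hq.natDegree_le j)
    fin_cases i
    · exact h 0 0
    · exact natDegree_add_le_of_degree_le (h 0 1) (h 1 0)
    · exact h 1 1
  exists_coeff_ne_zero := by
    have h (i j) : (p i * q j).coeff (d + e) = (p i).coeff d * (q j).coeff e :=
      coeff_mul_add_eq_of_natDegree_le (hp.natDegree_le i) (hq.natDegree_le j)
    obtain ⟨i, hi⟩ := hp.exists_coeff_ne_zero
    obtain ⟨j, hj⟩ := hq.exists_coeff_ne_zero
    by_contra! H
    refine symProd_ne_zero (p := fun i ↦ (p i).coeff d) (q := fun i ↦ (q i).coeff e)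
      (fun h ↦ hi (congrFun h i)) (fun h ↦ hj (congrFun h j)) ?_
    ext k
    rw [Pi.zero_apply, ← H k]
    fin_cases k <;> simp [HasPolyHeight.symProd, h]

/-! ### The addition-and-subtraction map doubles heights -/

variable (W : WeierstrassCurve F)

/-- The addition-and-subtraction map on vectors of polynomials. -/
noncomputable def addSub (v : Fin 3 → F[X]) (i : Fin 3) : F[X] :=
  ((W.map C).addSubMap i).eval v

theorem coeff_mul_mul {v : Fin 3 → F[X]} {d : ℕ} (h : ∀ i, (v i).natDegree ≤ d) (a : F)
    (i j : Fin 3) : (C a * v i * v j).coeff (d + d) = a * (v i).coeff d * (v j).coeff d := by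
  rw [mul_assoc, coeff_C_mul, coeff_mul_add_eq_of_natDegree_le (h i) (h j), mul_assoc]

/-- The components are quadratic forms with constant coefficients, so passing to top coefficients
commutes with the map. -/
theorem addSub_aux {v : Fin 3 → F[X]} {d : ℕ} (h : ∀ i, (v i).natDegree ≤ d) (i : Fin 3) :
    (addSub W v i).natDegree ≤ d + d ∧
      (addSub W v i).coeff (d + d) = (W.addSubMap i).eval (fun j ↦ (v j).coeff d) := by
  have hm (a : F) (i j) : (C a * v i * v j).natDegree ≤ d + d :=
    natDegree_mul_le_of_le ((natDegree_C_mul_le _ _).trans (h i)) (h j)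
  have hc := coeff_mul_mul h
  fin_cases i
  · have : addSub W v 0 = C 1 * v 0 * v 0 - C W.b₄ * v 0 * v 2 - C W.b₆ * v 1 * v 2
        - C W.b₈ * v 2 * v 2 := by
      rw [addSub, WeierstrassCurve.eval_addSubMap_zero]
      simp
      ring
    refine ⟨?_, ?_⟩
    · simp only [Fin.zero_eta, this]
      exact natDegree_sub_le_of_le (natDegree_sub_le_of_le (natDegree_sub_le_of_le (hm ..) (hm ..))
        (hm ..)) (hm ..)  |>.trans (by simp)
    · simp only [Fin.zero_eta, this, coeff_sub, hc, WeierstrassCurve.eval_addSubMap_zero]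
      ring
  · have : addSub W v 1 = C 2 * v 1 * v 0 + C W.b₂ * v 0 * v 2 + C W.b₄ * v 1 * v 2
        + C W.b₆ * v 2 * v 2 := by
      rw [addSub, WeierstrassCurve.eval_addSubMap_one]
      simp [← C_ofNat]
      ring
    refine ⟨?_, ?_⟩
    · simp only [Fin.mk_one, this]
      exact natDegree_add_le_of_le (natDegree_add_le_of_le (natDegree_add_le_of_le (hm ..) (hm ..))
        (hm ..)) (hm ..)  |>.trans (by simp)
    · simp only [Fin.mk_one, this, coeff_add, hc, WeierstrassCurve.eval_addSubMap_one]
      ring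
  · have : addSub W v 2 = C 1 * v 1 * v 1 - C 4 * v 0 * v 2 := by
      rw [addSub, WeierstrassCurve.eval_addSubMap_two]
      simp [← C_ofNat]
      ring
    refine ⟨?_, ?_⟩
    · simp only [Fin.reduceFinMk, this]
      exact natDegree_sub_le_of_le (hm ..) (hm ..)  |>.trans (by simp)
    · simp only [Fin.reduceFinMk, this, coeff_sub, hc, WeierstrassCurve.eval_addSubMap_two]
      ring

/-- The curve is constant, so it stays elliptic over every residue field of `F[X]`, where the
quadratic forms have no common nontrivial zero. -/
theorem span_addSub [W.IsElliptic] {v : Fin 3 → F[X]} (hv : Ideal.span (Set.range v) = ⊤) :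
    Ideal.span (Set.range (addSub W v)) = ⊤ := by
  rw [span_eq_top_iff] at hv ⊢
  intro M hM
  obtain ⟨i, hi⟩ := hv M hM
  by_contra! H
  let := Ideal.Quotient.field M
  let φ : F[X] →+* F[X] ⧸ M := Ideal.Quotient.mk M
  refine (W.map (φ.comp C)).addSubMap_ne_zero (x := φ ∘ v)
    (fun h ↦ hi (Ideal.Quotient.eq_zero_iff_mem.mp (congrFun h i))) ?_
  ext k
  have hk : φ (addSub W v k) = 0 := Ideal.Quotient.eq_zero_iff_mem.mpr (H k)
  rw [Pi.zero_apply, ← hk, addSub]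
  fin_cases k <;>
    simp [WeierstrassCurve.eval_addSubMap_zero, WeierstrassCurve.eval_addSubMap_one,
      WeierstrassCurve.eval_addSubMap_two, map_ofNat φ]

theorem addSub_two_mul [W.IsElliptic] {v : Fin 3 → F[X]} {d : ℕ} (hv : HasPolyHeight v d) :
    HasPolyHeight (addSub W v) (d + d) where
  span_eq_top := span_addSub W hv.span_eq_top
  natDegree_le i := (addSub_aux W hv.natDegree_le i).1
  exists_coeff_ne_zero := by
    obtain ⟨i, hi⟩ := hv.exists_coeff_ne_zero
    by_contra! H
    refine W.addSubMap_ne_zero (x := fun j ↦ (v j).coeff d) (fun h ↦ hi (congrFun h i)) ?_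
    ext k
    rw [Pi.zero_apply, ← H k, (addSub_aux W hv.natDegree_le k).2]

end HasPolyHeight

/-! ### Heights on a constant elliptic curve twisted by a polynomial -/

namespace WeierstrassCurve

open Polynomial HasPolyHeight

/-- The twist of the curve `y² = x³ + a₂ x² + a₄ x + a₆` by `l`. -/
def quadTwist {R : Type*} [CommRing R] (W : WeierstrassCurve R) (l : R) : WeierstrassCurve R :=
  ⟨0, l * W.a₂, 0, l ^ 2 * W.a₄, l ^ 3 * W.a₆⟩

variable {F : Type*} [Field F] (W : WeierstrassCurve F) (l : F[X])
  (K : Type*) [Field K] [Algebra F[X] K]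

/-- The twist by `l` of the curve `W` over `F`, over an extension `K` of `F(t)`. -/
noncomputable abbrev polyTwist : WeierstrassCurve K :=
  ((W.map C).quadTwist l).map (algebraMap F[X] K)

variable {W l K}

/-- The point `P` has `x`-coordinate `l * x` with `x` of height `d`. -/
def HasTwistHeight (P : (W.polyTwist l K).toAffine.Point) (d : ℕ) : Prop :=
  ∃ p : Fin 2 → F[X], HasPolyHeight p d ∧ ∃ c : K, c ≠ 0 ∧
    P.xRep 0 = c * algebraMap F[X] K (l * p 0) ∧ P.xRep 1 = c * algebraMap F[X] K (p 1)

/-- Two primitive representatives of one point of the projective line are proportional. -/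
theorem HasTwistHeight.eq [IsFractionRing F[X] K] (hl : l ≠ 0)
    {P : (W.polyTwist l K).toAffine.Point} {d e : ℕ}
    (hd : HasTwistHeight P d) (he : HasTwistHeight P e) : d = e := by
  obtain ⟨p, hp, c, hc, hp0, hp1⟩ := hd
  obtain ⟨q, hq, c', hc', hq0, hq1⟩ := he
  have hl' : algebraMap F[X] K l ≠ 0 := by simpa
  have key : p 0 * q 1 = p 1 * q 0 := by
    apply IsFractionRing.injective F[X] K
    simp only [map_mul] at *
    have : (c * c' * algebraMap F[X] K l) ≠ 0 := by positivity
    apply mul_left_cancel₀ this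
    linear_combination (-c' * algebraMap F[X] K (q 1)) * hp0 + (c * algebraMap F[X] K (p 1)) * hq0
      + P.xRep 0 * (hp1 - hq1)
  refine hp.eq_of_cross hq fun i j ↦ ?_
  fin_cases i <;> fin_cases j <;> simp [mul_comm, key]

theorem exists_hasTwistHeight [IsFractionRing F[X] K] (hl : l ≠ 0)
    (P : (W.polyTwist l K).toAffine.Point) : ∃ d, HasTwistHeight P d := by
  have hl' : algebraMap F[X] K l ≠ 0 := by simpa
  suffices h : ∃ p : Fin 2 → F[X], Ideal.span (Set.range p) = ⊤ ∧ ∃ c : K, c ≠ 0 ∧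
      P.xRep 0 = c * algebraMap F[X] K (l * p 0) ∧ P.xRep 1 = c * algebraMap F[X] K (p 1) by
    obtain ⟨p, hp, h⟩ := h
    obtain ⟨d, hd⟩ := exists_of_span_eq_top hp
    exact ⟨d, p, hd, h⟩
  match P with
  | 0 =>
    -- The factor `l⁻¹` absorbs the twist, so the point at infinity has height `0`.
    refine ⟨![1, 0], Ideal.eq_top_of_isUnit_mem _ (Ideal.subset_span ⟨0, rfl⟩) isUnit_one,
      (algebraMap F[X] K l)⁻¹, inv_ne_zero hl', ?_, ?_⟩ <;> simp [hl']
  | .some x y h =>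
    obtain ⟨n, d, hnd, hx⟩ := IsFractionRing.exists_reduced_fraction (A := F[X])
      (x / algebraMap F[X] K l)
    have hd0 : algebraMap F[X] K d ≠ 0 := IsFractionRing.to_map_ne_zero_of_mem_nonZeroDivisors d.2
    refine ⟨![n, d], ?_, (algebraMap F[X] K d)⁻¹, inv_ne_zero hd0, ?_, ?_⟩
    · replace hnd := hnd.isCoprime
      have : Set.range ![n, (d : F[X])] = {n, (d : F[X])} := by simp [Set.pair_comm]
      rw [this, Ideal.eq_top_iff_one, Ideal.mem_span_pair]
      exact hnd
    · rw [IsFractionRing.mk'_eq_div, div_eq_div_iff hd0 hl'] at hx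
      simp
      field_simp
      linear_combination -hx
    · simp [hd0]

/-- Twisting multiplies `b₂, b₄, b₆, b₈` by `l, l², l³, l⁴`. With weight `2 - i` on the `i`-th
coordinate the forms are isobaric, of weight `4 - i`. -/
theorem eval_addSubMap_polyTwist (h₁ : W.a₁ = 0) (h₃ : W.a₃ = 0) (s : Fin 3 → F[X]) (c : K)
    (v : Fin 3 → K) (hv : ∀ i, v i = c * algebraMap F[X] K (l ^ (2 - (i : ℕ)) * s i)) (i : Fin 3) :
    ((W.polyTwist l K).addSubMap i).eval v =
      c ^ 2 * algebraMap F[X] K (l ^ (4 - (i : ℕ)) * addSub W s i) := by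
  have h0 := hv 0
  have h1 := hv 1
  have h2 := hv 2
  fin_cases i <;>
  · simp only [Fin.zero_eta, Fin.mk_one, Fin.reduceFinMk, addSub, eval_addSubMap_zero,
      eval_addSubMap_one, eval_addSubMap_two, h0, h1, h2]
    simp [quadTwist, b₂, b₄, b₆, b₈, h₁, h₃, map_ofNat (algebraMap F[X] K)]
    ring

/-- The vector `symProd r s` of height `f + g` represents the image of `symProd p q`, of height `d +
e`, under a map that exactly doubles heights. Both are primitive, so proportionality gives equality.
-/
theorem HasTwistHeight.parallelogram [W.IsElliptic] [DecidableEq K] [IsFractionRing F[X] K]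
    (h₁ : W.a₁ = 0) (h₃ : W.a₃ = 0)
    (hl : l ≠ 0) {P Q : (W.polyTwist l K).toAffine.Point} {d e f g : ℕ}
    (hP : HasTwistHeight P d) (hQ : HasTwistHeight Q e) (hadd : HasTwistHeight (P + Q) f)
    (hsub : HasTwistHeight (P - Q) g) : f + g = 2 * (d + e) := by
  obtain ⟨p, hp, cp, hcp, hp0, hp1⟩ := hP
  obtain ⟨q, hq, cq, hcq, hq0, hq1⟩ := hQ
  obtain ⟨r, hr, cr, hcr, hr0, hr1⟩ := hadd
  obtain ⟨s, hs, cs, hcs, hs0, hs1⟩ := hsub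
  have hl' : algebraMap F[X] K l ≠ 0 := by simpa
  have key (P Q : (W.polyTwist l K).toAffine.Point) (p q : Fin 2 → F[X]) (cp cq : K)
      (hp0 : P.xRep 0 = cp * algebraMap F[X] K (l * p 0))
      (hp1 : P.xRep 1 = cp * algebraMap F[X] K (p 1))
      (hq0 : Q.xRep 0 = cq * algebraMap F[X] K (l * q 0))
      (hq1 : Q.xRep 1 = cq * algebraMap F[X] K (q 1)) (i : Fin 3) :
      P.sym2x Q i = (cp * cq) * algebraMap F[X] K (l ^ (2 - (i : ℕ)) * symProd p q i) := by
    simp only [Affine.Point.sym2x, hp0, hp1, hq0, hq1]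
    fin_cases i <;> simp [symProd] <;> ring
  obtain ⟨c, hc⟩ := Affine.Point.exists_eval_addSubMap_sym2x (W := (W.polyTwist l K).toAffine)
    (by simp [quadTwist]) (by simp [quadTwist]) P Q
  have hT := eval_addSubMap_polyTwist (K := K) h₁ h₃ (symProd p q) (cp * cq) _
    (key P Q p q cp cq hp0 hp1 hq0 hq1)
  have hS := key (P + Q) (P - Q) r s cr cs hr0 hr1 hs0 hs1
  have H (i : Fin 3) : (cp * cq) ^ 2 * algebraMap F[X] K l ^ 2 *
      algebraMap F[X] K (addSub W (symProd p q) i) =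
      c * (cr * cs) * algebraMap F[X] K (symProd r s i) := by
    have := (hT i).symm.trans ((hc i).trans (congrArg _ (hS i)))
    -- The weights on the two sides differ by the factor `l²`, independent of `i`; the rest cancels.
    rw [show 4 - (i : ℕ) = (2 - (i : ℕ)) + 2 by omega] at this
    have hli : algebraMap F[X] K l ^ (2 - (i : ℕ)) ≠ 0 := pow_ne_zero _ hl'
    simp only [map_mul, map_pow] at this
    apply mul_left_cancel₀ hli
    linear_combination this
  have := (hr.symProd_add hs).eq_of_cross ((hp.symProd_add hq).addSub_two_mul W) fun i j ↦ by
    apply IsFractionRing.injective F[X] K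
    have h0 : (cp * cq) ^ 2 * algebraMap F[X] K l ^ 2 ≠ 0 := by positivity
    apply mul_left_cancel₀ h0
    simp only [map_mul]
    linear_combination algebraMap F[X] K (symProd r s i) * H j -
      algebraMap F[X] K (symProd r s j) * H i
  omega

/-- The discriminant inequality for the quadratic form `d(mP + nQ)` when `d(Q) = 1`. -/
theorem HasTwistHeight.sq_le [W.IsElliptic] [DecidableEq K] [IsFractionRing F[X] K]
    (h₁ : W.a₁ = 0) (h₃ : W.a₃ = 0)
    (hl : l ≠ 0) {P Q : (W.polyTwist l K).toAffine.Point} {d e : ℕ}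
    (hP : HasTwistHeight P d) (hQ : HasTwistHeight Q 1) (hsub : HasTwistHeight (P - Q) e) :
    ((e : ℤ) - d - 1) ^ 2 ≤ 4 * d := by
  choose h hh using exists_hasTwistHeight (W := W) (K := K) hl
  have par (A B) : (h (A + B) : ℤ) + h (A - B) = 2 * (h A + h B) := by
    exact_mod_cast parallelogram h₁ h₃ hl (hh A) (hh B) (hh (A + B)) (hh (A - B))
  obtain rfl := hP.eq hl (hh P)
  obtain rfl := hsub.eq hl (hh _)
  have hQ1 : (h Q : ℤ) = 1 := by exact_mod_cast (hh Q).eq hl hQ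
  have h0 : (h 0 : ℤ) = 0 := by
    have := par 0 0
    simp only [add_zero, sub_zero] at this
    omega
  have h2 : (h (P + P) : ℤ) = 4 * h P := by
    have := par P P
    rw [sub_self, h0] at this
    omega
  have hm : (h (P + P - Q) : ℤ) = 4 * h P + 2 * (h (P - Q) - h P - 1) + 1 := by
    have := par P (P - Q)
    rw [sub_sub_cancel, hQ1, ← add_sub_assoc] at this
    omega
  set b : ℤ := h (P - Q) - h P - 1
  -- The parallelogram law with `Q` fixes the second difference in `n`, so two consecutive values
  -- carry the induction.
  have key (n : ℕ) : (h (P + P - n • Q) : ℤ) = 4 * h P + 2 * n * b + n ^ 2 ∧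
      (h (P + P - (n + 1) • Q) : ℤ) = 4 * h P + 2 * (n + 1) * b + (n + 1) ^ 2 := by
    induction n with
    | zero => simpa [h2] using hm
    | succ n ih =>
      refine ⟨by push_cast; exact ih.2, ?_⟩
      have := par (P + P - (n + 1) • Q) Q
      rw [show P + P - (n + 1) • Q + Q = P + P - n • Q by rw [add_smul, one_smul]; abel,
        show P + P - (n + 1) • Q - Q = P + P - (n + 1 + 1) • Q by
          rw [add_smul (n + 1), one_smul]; abel, ih.1, ih.2, hQ1] at this
      push_cast
      linarith
  have key' (n : ℕ) : (h (P + P + n • Q) : ℤ) = 4 * h P - 2 * n * b + n ^ 2 ∧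
      (h (P + P + (n + 1) • Q) : ℤ) = 4 * h P - 2 * (n + 1) * b + (n + 1) ^ 2 := by
    induction n with
    | zero =>
      refine ⟨by simpa using h2, ?_⟩
      have := par (P + P) Q
      simp only [zero_add, one_smul]
      rw [hm, h2, hQ1] at this
      push_cast
      linarith
    | succ n ih =>
      refine ⟨by push_cast; exact ih.2, ?_⟩
      have := par (P + P + (n + 1) • Q) Q
      rw [show P + P + (n + 1) • Q - Q = P + P + n • Q by rw [add_smul, one_smul]; abel,
        show P + P + (n + 1) • Q + Q = P + P + (n + 1 + 1) • Q by
          rw [add_smul (n + 1), one_smul]; abel, ih.1, ih.2, hQ1] at this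
      push_cast
      linarith
  -- Starting from `2P` puts the minimum of the quadratic at an integer: for `n = |b|` and the right
  -- sign the height is `4 h(P) - b²`, which is nonnegative.
  obtain ⟨n, hn | hn⟩ := Int.eq_nat_or_neg b
  · have := (key' n).1
    rw [← hn] at this
    nlinarith [Int.natCast_nonneg (h (P + P + n • Q))]
  · have := (key n).1
    rw [show (n : ℤ) = -b by omega] at this
    nlinarith [Int.natCast_nonneg (h (P + P - n • Q))]

end WeierstrassCurve

/-! ### The Hasse bound -/

namespace WeierstrassCurve

open Polynomial HasPolyHeight

section FiniteField

variable {F : Type*} [Field F]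

theorem prod_X_sub_C_univ_eq [Fintype F] :
    ∏ a : F, (X - C a) = (X ^ Fintype.card F - X : F[X]) := by
  have h := C_leadingCoeff_mul_prod_multiset_X_sub_C (p := (X ^ Fintype.card F - X : F[X])) (by
    rw [FiniteField.roots_X_pow_card_sub_X,
      FiniteField.X_pow_card_sub_X_natDegree_eq _ Fintype.one_lt_card]
    rfl)
  have hm : (X ^ Fintype.card F - X : F[X]).leadingCoeff = 1 := by
    rw [leadingCoeff, FiniteField.X_pow_card_sub_X_natDegree_eq _ Fintype.one_lt_card]
    simp [coeff_X, Fintype.one_lt_card.ne]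
  rw [hm, FiniteField.roots_X_pow_card_sub_X, C_1, one_mul] at h
  exact h

theorem prod_X_sub_C_dvd {s : Finset F} {p : F[X]} (h : ∀ a ∈ s, p.eval a = 0) :
    ∏ a ∈ s, (X - C a) ∣ p :=
  Finset.prod_dvd_of_coprime (fun _ _ _ _ hab ↦ pairwise_coprime_X_sub_C
    Function.injective_id hab) fun a ha ↦ dvd_iff_isRoot.mpr (h a ha)

end FiniteField

/-! ### The cubic `f`, its roots and the count of solutions of `y² = f(x)` -/

section

variable {F : Type*} [Field F] (W : WeierstrassCurve F)

/-- The cubic polynomial `X³ + a₂ X² + a₄ X + a₆`. -/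
noncomputable def cubicPoly : F[X] := X ^ 3 + C W.a₂ * X ^ 2 + C W.a₄ * X + C W.a₆

theorem natDegree_cubicPoly : W.cubicPoly.natDegree = 3 := by
  rw [cubicPoly]
  compute_degree!

theorem cubicPoly_ne_zero : W.cubicPoly ≠ 0 := by
  intro h
  have := W.natDegree_cubicPoly
  simp [h] at this

/-- The point `(a, 0)` is nonsingular and the `y`-derivative `2y` vanishes there, so the
`x`-derivative cannot. -/
theorem eval_derivative_cubicPoly_ne_zero [W.IsElliptic] (h₁ : W.a₁ = 0) (h₃ : W.a₃ = 0) {a : F}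
    (ha : W.cubicPoly.eval a = 0) : W.cubicPoly.derivative.eval a ≠ 0 := by
  have he : W.toAffine.Equation a 0 := by
    rw [Affine.equation_iff]
    simp [cubicPoly] at ha
    linear_combination -ha
  have hn := W.toAffine.equation_iff_nonsingular.mp he
  rw [Affine.nonsingular_iff] at hn
  rcases hn.2 with h | h
  · simp [h₁] at h
    simp [cubicPoly]
    contrapose! h
    linear_combination -h
  · simp [h₁, h₃] at h

/-- The coefficients are fixed by Frobenius, so `f^q = f(X^q)`. This puts the Frobenius point on the
twist. -/
theorem cubicPoly_pow_card [Fintype F] : W.cubicPoly ^ Fintype.card F =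
    (X ^ Fintype.card F) ^ 3 + C W.a₂ * (X ^ Fintype.card F) ^ 2 + C W.a₄ * X ^ Fintype.card F
      + C W.a₆ := by
  rw [← FiniteField.expand_card]
  simp [cubicPoly]

variable {W} in
theorem isElliptic_polyTwist [W.IsElliptic] (h₁ : W.a₁ = 0) (h₃ : W.a₃ = 0) (K : Type*) [Field K]
    [Algebra F[X] K] [IsFractionRing F[X] K] : (W.polyTwist W.cubicPoly K).IsElliptic := by
  rw [isElliptic_iff, isUnit_iff_ne_zero, map_Δ]
  have h : ((W.map C).quadTwist W.cubicPoly).Δ = W.cubicPoly ^ 6 * (W.map C).Δ := by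
    simp [quadTwist, Δ, b₂, b₄, b₆, b₈, h₁, h₃]
    ring
  have hc := W.cubicPoly_ne_zero
  have hΔ : W.Δ ≠ 0 := W.isUnit_Δ.ne_zero
  rw [h, map_Δ]
  simp [hc, hΔ]

/-- Euler's criterion: the fiber over `a` has one point if `f(a) = 0`, two if `f(a)^((q-1)/2) = 1`
and none otherwise. -/
theorem card_cubicPoly_sq_eq [Fintype F] [DecidableEq F] (hF : ringChar F ≠ 2) :
    Nat.card {p : F × F // p.2 ^ 2 = W.cubicPoly.eval p.1} =
      ({a | W.cubicPoly.eval a = 0} : Finset F).card + 2 *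
        ({a | W.cubicPoly.eval a ^ (Fintype.card F / 2) = 1} : Finset F).card := by
  have h2 : 0 < Fintype.card F / 2 := Nat.div_pos Fintype.one_lt_card two_pos
  have e : {p : F × F // p.2 ^ 2 = W.cubicPoly.eval p.1} ≃
      Σ a : F, {y : F // y ^ 2 = W.cubicPoly.eval a} :=
    { toFun p := ⟨p.1.1, p.1.2, p.2⟩
      invFun p := ⟨(p.1, p.2.1), p.2.2⟩
      left_inv _ := rfl
      right_inv _ := rfl }
  rw [Nat.card_congr e, Nat.card_sigma]
  have hy (a : F) : Nat.card {y : F // y ^ 2 = W.cubicPoly.eval a} =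
      (if W.cubicPoly.eval a = 0 then 1 else 0) +
        2 * (if W.cubicPoly.eval a ^ (Fintype.card F / 2) = 1 then 1 else 0) := by
    have := quadraticChar_card_sqrts hF (W.cubicPoly.eval a)
    rw [Set.toFinset_card, ← Nat.card_eq_fintype_card] at this
    zify
    refine Eq.trans this ?_
    by_cases h0 : W.cubicPoly.eval a = 0
    · simp [h0, h2.ne']
    · rw [quadraticChar_eq_pow_of_char_ne_two hF h0]
      split_ifs <;> simp_all
  simp only [hy, Finset.sum_add_distrib, ← Finset.mul_sum, Finset.sum_boole, Nat.cast_id]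

theorem card_eq_add_add [Fintype F] [DecidableEq F] (hF : ringChar F ≠ 2) (p : F[X]) :
    Fintype.card F = ({a | p.eval a = 0} : Finset F).card +
      ({a | p.eval a ^ (Fintype.card F / 2) = 1} : Finset F).card +
      ({a | p.eval a ^ (Fintype.card F / 2) = -1} : Finset F).card := by
  have h2 : 0 < Fintype.card F / 2 := Nat.div_pos Fintype.one_lt_card two_pos
  have hne : (1 : F) ≠ -1 := (Ring.neg_one_ne_one_of_char_ne_two hF).symm
  rw [← Finset.card_union_of_disjoint, ← Finset.card_union_of_disjoint, ← Finset.card_univ]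
  · congr 1
    ext a
    simp only [Finset.mem_union, Finset.mem_filter_univ, Finset.mem_univ, true_iff]
    by_cases h0 : p.eval a = 0
    · exact .inl (.inl h0)
    · exact (FiniteField.pow_dichotomy hF h0).imp_left .inr
  · rw [Finset.disjoint_left]
    intro a ha hb
    simp only [Finset.mem_union, Finset.mem_filter_univ] at ha hb
    rcases ha with h | h
    · simp [h, h2.ne'] at hb
    · exact hne (h.symm.trans hb)
  · rw [Finset.disjoint_left]
    intro a ha hb
    simp only [Finset.mem_filter_univ] at ha hb
    simp [ha, h2.ne'] at hb

end

end WeierstrassCurve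

/-! ### Cancellation in the `x`-coordinate of Frobenius minus identity -/

namespace WeierstrassCurve

open Polynomial HasPolyHeight

variable {F : Type*} [Field F] [Fintype F] (W : WeierstrassCurve F)

/-- This is the unreduced numerator of `x(P - Q)/f`. With `f(f^((q-1)/2) + 1)² = f^q + 2f^((q+1)/2)
+ f` and `f^q = f(X^q)`, the terms `X^(3q)` and `a₂X^(2q)` cancel and `X^(2q+1)` survives. The
middle term has degree `3(q+1)/2 ≤ 2q` because `q ≥ 3`. -/
theorem natDegree_frobenius_sub (hF : ringChar F ≠ 2) :
    (W.cubicPoly * (W.cubicPoly ^ (Fintype.card F / 2) + 1) ^ 2 -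
      (C W.a₂ + X ^ Fintype.card F + X) * (X ^ Fintype.card F - X) ^ 2).natDegree =
      2 * Fintype.card F + 1 := by
  set q := Fintype.card F with hq
  have hodd : q = 2 * (q / 2) + 1 := by
    have := FiniteField.odd_card_of_char_ne_two hF
    omega
  have hq3 : 3 ≤ q := by
    have : 1 < q := Fintype.one_lt_card
    omega
  have key : W.cubicPoly * (W.cubicPoly ^ (q / 2) + 1) ^ 2 -
      (C W.a₂ + X ^ q + X) * (X ^ q - X) ^ 2 = X ^ (2 * q + 1) +
        (C W.a₄ * X ^ q + C W.a₆ + X ^ (q + 2) - X ^ 3 + C (2 * W.a₂) * X ^ (q + 1) -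
          C W.a₂ * X ^ 2 + W.cubicPoly + C 2 * W.cubicPoly ^ (q / 2 + 1)) := by
    have h := W.cubicPoly_pow_card
    rw [← hq] at h
    have h' : W.cubicPoly ^ q = W.cubicPoly * (W.cubicPoly ^ (q / 2)) ^ 2 := by
      conv_lhs => rw [hodd]
      ring
    rw [h'] at h
    rw [C_mul]
    have h2 : (C 2 : F[X]) = 2 := rfl
    rw [h2]
    linear_combination h
  rw [key]
  have hdeg : (C W.a₄ * X ^ q + C W.a₆ + X ^ (q + 2) - X ^ 3 + C (2 * W.a₂) * X ^ (q + 1) -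
      C W.a₂ * X ^ 2 + W.cubicPoly + C 2 * W.cubicPoly ^ (q / 2 + 1)).natDegree ≤ 2 * q := by
    have hc := W.natDegree_cubicPoly
    have h1 : (C 2 * W.cubicPoly ^ (q / 2 + 1)).natDegree ≤ 2 * q := by
      refine (natDegree_C_mul_le _ _).trans ?_
      rw [natDegree_pow, hc]
      omega
    refine natDegree_add_le_of_degree_le (natDegree_add_le_of_degree_le ?_ (by omega)) h1
    compute_degree
    all_goals omega
  rw [natDegree_add_eq_left_of_natDegree_lt] <;> rw [natDegree_X_pow]
  omega

/-- `X^q - X` is the product of `X - a` over all `a`. A root of `f` contributes one factor to the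
gcd, since it is a simple root of `f` and `f^((q-1)/2) + 1` is `1` there; an `a` with `f(a)` a
nonsquare contributes two, and one with `f(a)` a nonzero square none. Hence `deg G = |s₀| + 2|s₂|`,
while the point count is `|s₀| + 2|s₁|`. -/
theorem exists_frobenius_factorization [DecidableEq F] [W.IsElliptic] (hF : ringChar F ≠ 2)
    (h₁ : W.a₁ = 0) (h₃ : W.a₃ = 0) :
    ∃ G H G' : F[X], W.cubicPoly * (W.cubicPoly ^ (Fintype.card F / 2) + 1) ^ 2 = G * H ∧
      (X ^ Fintype.card F - X) ^ 2 = G * G' ∧ IsCoprime H G' ∧ G ≠ 0 ∧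
      G.natDegree + Nat.card {p : F × F // p.2 ^ 2 = W.cubicPoly.eval p.1} =
        2 * Fintype.card F := by
  have h2 : (2 : F) ≠ 0 := Ring.two_ne_zero hF
  have hpos : Fintype.card F / 2 ≠ 0 := (Nat.div_pos Fintype.one_lt_card two_pos).ne'
  rw [W.card_cubicPoly_sq_eq hF]
  have hcard := card_eq_add_add hF W.cubicPoly
  set m := Fintype.card F / 2
  set f := W.cubicPoly
  set s₀ : Finset F := {a | f.eval a = 0}
  set s₁ : Finset F := {a | f.eval a ^ m = 1}
  set s₂ : Finset F := {a | f.eval a ^ m = -1}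
  have hs₀ {a} : a ∈ s₀ ↔ f.eval a = 0 := by simp [s₀]
  have hs₁ {a} : a ∈ s₁ ↔ f.eval a ^ m = 1 := by simp [s₁]
  have hs₂ {a} : a ∈ s₂ ↔ f.eval a ^ m = -1 := by simp [s₂]
  let Q (s : Finset F) : F[X] := ∏ a ∈ s, (X - C a)
  have hmonic (s : Finset F) : (Q s).Monic := monic_prod_X_sub_C _ _
  obtain ⟨f₁, hf₁⟩ : Q s₀ ∣ f := prod_X_sub_C_dvd fun a ha ↦ hs₀.mp ha
  obtain ⟨g₁, hg₁⟩ : Q s₂ ∣ f ^ m + 1 := prod_X_sub_C_dvd fun a ha ↦ by simp [hs₂.mp ha]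
  have hD : (X ^ Fintype.card F - X : F[X]) = Q s₀ * Q s₁ * Q s₂ := by
    rw [← prod_X_sub_C_univ_eq]
    have d₁ : Disjoint s₀ s₁ := Finset.disjoint_left.mpr fun a ha hb ↦ by
      rw [hs₀] at ha; rw [hs₁, ha, zero_pow hpos] at hb; simp at hb
    have d₂ : Disjoint (s₀ ∪ s₁) s₂ := Finset.disjoint_left.mpr fun a ha hb ↦ by
      rw [Finset.mem_union, hs₀, hs₁] at ha
      rw [hs₂] at hb
      rcases ha with ha | ha
      · rw [ha, zero_pow hpos] at hb; simp at hb
      · exact Ring.neg_one_ne_one_of_char_ne_two hF (hb.symm.trans ha)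
    simp only [Q]
    rw [← Finset.prod_union d₁, ← Finset.prod_union d₂]
    congr 1
    symm
    rw [← Finset.card_eq_iff_eq_univ, Finset.card_union_of_disjoint d₂,
      Finset.card_union_of_disjoint d₁, hcard]
  refine ⟨Q s₀ * Q s₂ ^ 2, f₁ * g₁ ^ 2, Q s₀ * Q s₁ ^ 2, ?_, ?_, ?_, ?_, ?_⟩
  · rw [hg₁]
    nth_rw 1 [hf₁]
    ring
  · rw [hD]
    ring
  -- `G'` is a product of linear factors, so it suffices that `H` vanishes at none of their roots.
  · have hcop {a : F} {p : F[X]} (h : p.eval a ≠ 0) : IsCoprime p (X - C a) :=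
      ((irreducible_X_sub_C a).coprime_iff_not_dvd.mpr (by
        rwa [dvd_iff_isRoot])).symm
    have hev₀ {a} (ha : a ∈ s₀) : (f₁ * g₁ ^ 2).eval a ≠ 0 := by
      rw [hs₀] at ha
      have hd := W.eval_derivative_cubicPoly_ne_zero h₁ h₃ ha
      change f.derivative.eval a ≠ 0 at hd
      have hr : (Q s₀).eval a = 0 := by
        simp only [Q, eval_prod]
        exact Finset.prod_eq_zero (hs₀.mpr ha) (by simp)
      rw [hf₁] at hd
      simp only [derivative_mul, eval_add, eval_mul, hr, zero_mul, add_zero] at hd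
      have hg := congrArg (eval a) hg₁
      simp only [eval_add, eval_pow, ha, eval_one, eval_mul, zero_pow hpos, zero_add] at hg
      simp only [eval_mul, eval_pow]
      refine mul_ne_zero (right_ne_zero_of_mul hd) (pow_ne_zero _ (right_ne_zero_of_mul (hg ▸ one_ne_zero)))
    have hev₁ {a} (ha : a ∈ s₁) : (f₁ * g₁ ^ 2).eval a ≠ 0 := by
      rw [hs₁] at ha
      have hfa : f.eval a ≠ 0 := by
        intro h
        rw [h, zero_pow hpos] at ha
        simp at ha
      have hg := congrArg (eval a) hg₁
      simp only [eval_add, eval_pow, ha, eval_one, eval_mul, one_add_one_eq_two] at hg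
      rw [hf₁, eval_mul] at hfa
      simp only [eval_mul, eval_pow]
      exact mul_ne_zero (right_ne_zero_of_mul hfa) (pow_ne_zero _ (right_ne_zero_of_mul (hg ▸ h2)))
    exact .mul_right (.prod_right fun a ha ↦ hcop (hev₀ ha))
      (.pow_right (.prod_right fun a ha ↦ hcop (hev₁ ha)))
  · exact ((hmonic s₀).mul ((hmonic s₂).pow 2)).ne_zero
  · rw [(hmonic s₀).natDegree_mul ((hmonic s₂).pow 2), (hmonic s₂).natDegree_pow]
    simp only [Q, natDegree_finsetProd_X_sub_C_eq_card]
    omega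

end WeierstrassCurve

/-! ### Hasse's bound from the heights of the Frobenius and identity points -/

namespace WeierstrassCurve

open Polynomial HasPolyHeight

section

variable {F : Type*} [Field F] (W : WeierstrassCurve F) (K : Type*) [Field K] [Algebra F[X] K]

variable {W} in
theorem equation_polyTwist {l x y : F[X]}
    (h : y ^ 2 = x ^ 3 + l * C W.a₂ * x ^ 2 + l ^ 2 * C W.a₄ * x + l ^ 3 * C W.a₆) :
    (W.polyTwist l K).toAffine.Equation (algebraMap F[X] K x) (algebraMap F[X] K y) := by
  refine Affine.Equation.map (W := ((W.map C).quadTwist l).toAffine) _ ?_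
  rw [Affine.equation_iff]
  simp [quadTwist]
  linear_combination h

theorem hasPolyHeight_X_pow_one (n : ℕ) :
    HasPolyHeight (![X ^ n, 1] : Fin 2 → F[X]) n where
  span_eq_top := Ideal.eq_top_of_isUnit_mem _ (Ideal.subset_span ⟨1, rfl⟩) isUnit_one
  natDegree_le i := by fin_cases i <;> simp
  exists_coeff_ne_zero := ⟨0, by simp⟩

end

variable {F : Type*} [Field F] [Finite F] {W : WeierstrassCurve F}

/-- In the coordinates of `f(t) y² = f(x)` the points are `P = (t^q, f^((q-1)/2))` and `Q = (t, 1)`;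
the extra factors `f` and `f²` come from the Weierstrass form of the twist. Their heights `q`, `1`
and `N + 1` for `P - Q` go into `HasTwistHeight.sq_le`. -/
theorem sq_card_cubicPoly_sub_le_aux (K : Type*) [Field K] [Algebra F[X] K]
    [IsFractionRing F[X] K] [W.IsElliptic] (hF : ringChar F ≠ 2)
    (h₁ : W.a₁ = 0) (h₃ : W.a₃ = 0) :
    ((Nat.card {p : F × F // p.2 ^ 2 = W.cubicPoly.eval p.1} : ℤ) - Nat.card F) ^ 2 ≤
      4 * Nat.card F := by
  classical
  have : Fintype F := Fintype.ofFinite F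
  rw [Nat.card_eq_fintype_card (α := F)]
  obtain ⟨G, H, G', hH, hG', hcop, hG, hdeg⟩ := W.exists_frobenius_factorization hF h₁ h₃
  have hnum := W.natDegree_frobenius_sub hF
  set f := W.cubicPoly
  set q := Fintype.card F
  set N := Nat.card {p : F × F // p.2 ^ 2 = f.eval p.1}
  have hq1 : 1 < q := Fintype.one_lt_card
  have hodd : q = 2 * (q / 2) + 1 := by
    have := FiniteField.odd_card_of_char_ne_two hF
    omega
  let φ : F[X] →+* K := algebraMap F[X] K
  have hφ {x : F[X]} (h : x ≠ 0) : φ x ≠ 0 := by simpa [φ]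
  have hf : f ≠ 0 := W.cubicPoly_ne_zero
  have hD : (X ^ q - X : F[X]) ≠ 0 := FiniteField.X_pow_card_sub_X_ne_zero _ hq1
  have hG'0 : G' ≠ 0 := by
    rintro rfl
    rw [mul_zero] at hG'
    exact pow_ne_zero 2 hD hG'
  have : (W.polyTwist f K).toAffine.IsElliptic := isElliptic_polyTwist h₁ h₃ K
  let E := (W.polyTwist f K).toAffine
  have hP : E.Equation (φ (f * X ^ q)) (φ (f ^ 2 * f ^ (q / 2))) := by
    refine equation_polyTwist K ?_
    have : (f ^ 2 * f ^ (q / 2)) ^ 2 = f ^ 3 * f ^ q := by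
      conv_rhs => rw [hodd]
      ring
    rw [this]
    simp only [f]
    rw [W.cubicPoly_pow_card]
    ring
  have hQ : E.Equation (φ (f * X)) (φ (f ^ 2)) := by
    refine equation_polyTwist K ?_
    simp only [f, cubicPoly]
    ring
  have hQ' : E.Equation (φ (f * X)) (φ (-f ^ 2)) := by
    refine equation_polyTwist K ?_
    simp only [f, cubicPoly]
    ring
  let P : E.Point := .some _ _ (E.equation_iff_nonsingular.mp hP)
  let Q : E.Point := .some _ _ (E.equation_iff_nonsingular.mp hQ)
  have hPh : HasTwistHeight (W := W) (l := f) (K := K) P q :=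
    ⟨_, hasPolyHeight_X_pow_one q, 1, one_ne_zero, by simp [P, φ], by simp [P]⟩
  have hQh : HasTwistHeight (W := W) (l := f) (K := K) Q 1 :=
    ⟨_, hasPolyHeight_X_pow_one 1, 1, one_ne_zero, by simp [Q, φ], by simp [Q]⟩
  have hx : φ (f * X ^ q) ≠ φ (f * X) := by
    rw [← sub_ne_zero, ← map_sub, ← mul_sub]
    exact hφ (mul_ne_zero hf hD)
  have hsub : HasTwistHeight (W := W) (l := f) (K := K) (P - Q) (N + 1) := by
    -- The addition formula gives `x(P - Q)/f` as this numerator over `(X^q - X)²`. Dividing both by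
    -- `G` leaves degree `2q + 1 - deg G = N + 1` on top and `2q - deg G = N` below.
    have hp₀ : f * (f ^ (q / 2) + 1) ^ 2 - (C W.a₂ + X ^ q + X) * (X ^ q - X) ^ 2 =
        G * (H - (C W.a₂ + X ^ q + X) * G') := by
      rw [hH, hG']
      ring
    have hp₀0 : H - (C W.a₂ + X ^ q + X) * G' ≠ 0 := by
      intro h
      rw [hp₀, h] at hnum
      simp at hnum
    have hdeg₀ : (H - (C W.a₂ + X ^ q + X) * G').natDegree = N + 1 := by
      rw [hp₀, natDegree_mul hG hp₀0] at hnum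
      omega
    have hdeg₁ : G'.natDegree ≤ N + 1 := by
      have := congrArg natDegree hG'
      rw [natDegree_pow, FiniteField.X_pow_card_sub_X_natDegree_eq _ hq1,
        natDegree_mul hG hG'0] at this
      omega
    refine ⟨![H - (C W.a₂ + X ^ q + X) * G', G'], ⟨?_, ?_, 0, ?_⟩, (φ G')⁻¹,
      inv_ne_zero (hφ hG'0), ?_, ?_⟩
    · have : Set.range ![H - (C W.a₂ + X ^ q + X) * G', G'] =
          {H - (C W.a₂ + X ^ q + X) * G', G'} := by simp [Set.pair_comm]
      rw [this, Ideal.eq_top_iff_one, Ideal.mem_span_pair]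
      obtain ⟨u, v, huv⟩ := hcop
      -- Subtracting a multiple of `G'` from `H` keeps it coprime to `G'`.
      exact ⟨u, v + u * (C W.a₂ + X ^ q + X), by linear_combination huv⟩
    · intro i
      fin_cases i
      exacts [hdeg₀.le, hdeg₁]
    · simp only [Matrix.cons_val_zero]
      rw [← hdeg₀]
      exact leadingCoeff_ne_zero.mpr hp₀0
    · have hneg : -Q = .some _ _ (E.equation_iff_nonsingular.mp hQ') := by
        simp only [Q, Affine.Point.neg_some]
        congr 1
        simp [Affine.negY, E, quadTwist]
      rw [sub_eq_add_neg, hneg, Affine.Point.add_of_X_ne hx, Affine.Point.xRep_some,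
        Affine.slope_of_X_ne hx]
      have hDφ : φ (X ^ q - X) ≠ 0 := hφ hD
      have hfφ : φ f ≠ 0 := hφ hf
      have hGφ := hφ hG'0
      have e₁ : E.a₁ = 0 := by simp [E, quadTwist]
      have e₂ : E.a₂ = φ f * φ (C W.a₂) := by simp [E, quadTwist, φ]
      -- This says that the squared slope equals `f H / G'`, after the common factor `G` is removed.
      have key : φ (f ^ 2 * (f ^ (q / 2) + 1) ^ 2 * G') =
          φ (f * (H * (X ^ q - X) ^ 2)) := by
        congr 1
        linear_combination f * G' * hH - f * H * hG'
      simp only [Affine.addX, e₁, e₂, Matrix.cons_val_zero]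
      change _ = (φ G')⁻¹ * φ (f * (H - (C W.a₂ + X ^ q + X) * G'))
      have hs : (φ (f ^ 2 * f ^ (q / 2)) - φ (-f ^ 2)) / (φ (f * X ^ q) - φ (f * X)) =
          φ (f * (f ^ (q / 2) + 1)) / φ (X ^ q - X) := by
        rw [← map_sub, ← map_sub, div_eq_div_iff (by rw [map_sub]; exact sub_ne_zero.mpr hx) hDφ,
          ← map_mul, ← map_mul]
        congr 1
        ring
      rw [hs]
      field_simp
      simp only [map_mul, map_pow, map_add, map_sub, map_one] at key ⊢
      linear_combination key
    · have hneg : -Q = .some _ _ (E.equation_iff_nonsingular.mp hQ') := by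
        simp only [Q, Affine.Point.neg_some]
        congr 1
        simp [Affine.negY, E, quadTwist]
      rw [sub_eq_add_neg, hneg, Affine.Point.add_of_X_ne hx]
      simp [φ, hG'0]
  have := HasTwistHeight.sq_le h₁ h₃ hf hPh hQh hsub
  push_cast at this
  linarith

theorem sq_card_cubicPoly_sub_le [W.IsElliptic] (hF : ringChar F ≠ 2)
    (h₁ : W.a₁ = 0) (h₃ : W.a₃ = 0) :
    ((Nat.card {p : F × F // p.2 ^ 2 = W.cubicPoly.eval p.1} : ℤ) - Nat.card F) ^ 2 ≤
      4 * Nat.card F :=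
  sq_card_cubicPoly_sub_le_aux (FractionRing F[X]) hF h₁ h₃

/-- **Hasse's theorem** for elliptic curves over finite fields of odd characteristic. -/
theorem sq_card_equation_sub_le (W : WeierstrassCurve F) [W.IsElliptic] (hF : ringChar F ≠ 2) :
    ((Nat.card {p : F × F // W.toAffine.Equation p.1 p.2} : ℤ) - Nat.card F) ^ 2 ≤
      4 * Nat.card F := by
  have h2 : (2 : F) ≠ 0 := Ring.two_ne_zero hF
  have h4 : (4 : F) ≠ 0 := by
    rw [show (4 : F) = 2 * 2 by norm_num]
    exact mul_ne_zero h2 h2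
  -- Completing the square, `y ↦ y + (a₁x + a₃)/2`, preserves the discriminant and the number of
  -- solutions.
  let W' : WeierstrassCurve F := ⟨0, W.b₂ / 4, 0, W.b₄ / 2, W.b₆ / 4⟩
  have hW' : W'.IsElliptic := by
    rw [isElliptic_iff]
    have : W'.Δ = W.Δ := by
      simp only [W', Δ, b₂, b₄, b₆, b₈]
      field_simp
      ring
    rw [this]
    exact W.isUnit_Δ
  have e : {p : F × F // W.toAffine.Equation p.1 p.2} ≃
      {p : F × F // p.2 ^ 2 = W'.cubicPoly.eval p.1} :=
    ((Equiv.prodShear (Equiv.refl F) fun x ↦ Equiv.addRight ((W.a₁ * x + W.a₃) / 2))).subtypeEquiv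
      fun p ↦ by
        rw [Affine.equation_iff]
        simp [Equiv.prodShear, cubicPoly, W', b₂, b₄, b₆]
        field_simp
        constructor <;> intro h
        · linear_combination 16 * h
        · apply mul_left_cancel₀ (mul_ne_zero h4 h4)
          linear_combination h
  rw [Nat.card_congr e]
  exact sq_card_cubicPoly_sub_le hF rfl rfl

end WeierstrassCurve

/-! ### The rings `ℤ[S⁻¹]` -/

namespace ZInv

theorem mono {S T : Finset Nat.Primes} (h : S ≤ T) : ZInv S ≤ ZInv T :=
  Algebra.adjoin_mono (Set.image_mono (by exact_mod_cast h))

theorem inv_mem {S : Finset Nat.Primes} {p : Nat.Primes} (hp : p ∈ S) :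
    ((p : ℕ) : ℚ)⁻¹ ∈ ZInv S :=
  Algebra.subset_adjoin ⟨p, hp, rfl⟩

theorem exists_inv_mem (n : ℕ) : ∃ S : Finset Nat.Primes, (n : ℚ)⁻¹ ∈ ZInv S := by
  classical
  induction n using Nat.recOnMul with
  | zero => exact ⟨∅, by simp⟩
  | one => exact ⟨∅, by simp⟩
  | prime p hp => exact ⟨{⟨p, hp⟩}, inv_mem (p := ⟨p, hp⟩) (Finset.mem_singleton_self _)⟩
  | mul a b ha hb =>
    obtain ⟨S, hS⟩ := ha
    obtain ⟨T, hT⟩ := hb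
    refine ⟨S ∪ T, ?_⟩
    rw [Nat.cast_mul, mul_inv]
    exact mul_mem (mono Finset.subset_union_left hS) (mono Finset.subset_union_right hT)

theorem exists_mem (r : ℚ) : ∃ S : Finset Nat.Primes, r ∈ ZInv S := by
  obtain ⟨S, hS⟩ := exists_inv_mem r.den
  refine ⟨S, ?_⟩
  rw [← Rat.num_div_den r, div_eq_mul_inv]
  exact mul_mem (intCast_mem _ _) hS

instance finiteType (S : Finset Nat.Primes) : Algebra.FiniteType ℤ (ZInv S) :=
  (ZInv S).fg_iff_finiteType.mp (Subalgebra.fg_def.mpr ⟨_, S.finite_toSet.image _, rfl⟩)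

/-- The image of `p⁻¹` is forced to be the inverse of `p`. Consequently `Spec ℤ[S⁻¹] ⟶ Spec ℤ` is a
monomorphism. -/
instance subsingleton_ringHom (S : Finset Nat.Primes) (A : Type*) [CommRing A] :
    Subsingleton (ZInv S →+* A) where
  allEq f g := by
    suffices h : f.toIntAlgHom = g.toIntAlgHom from congrArg AlgHom.toRingHom h
    refine AlgHom.adjoin_ext ?_
    rintro _ ⟨p, hp, rfl⟩
    set u : ZInv S := ⟨((p : ℕ) : ℚ)⁻¹, inv_mem hp⟩
    have hu : ((p : ℕ) : ZInv S) * u = 1 := by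
      apply Subtype.ext
      simp [u, p.2.ne_zero]
    have h₁ (f : ZInv S →+* A) : ((p : ℕ) : A) * f u = 1 := by
      rw [← map_natCast f, ← map_mul, hu, map_one]
    change f u = g u
    calc f u = (((p : ℕ) : A) * g u) * f u := by rw [h₁, one_mul]
      _ = (((p : ℕ) : A) * f u) * g u := by ring
      _ = g u := by rw [h₁, one_mul]

/-- `ℤ[S⁻¹]` lies in the localization of `ℤ` at the integers that are nonzero in `F`, and that
localization maps to `F`. -/
theorem nonempty_ringHom {S : Finset Nat.Primes} {F : Type*} [Field F]
    (hF : ∀ p ∈ S, ((p : ℕ) : F) ≠ 0) : Nonempty (ZInv S →+* F) := by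
  let M : Submonoid ℤ := (nonZeroDivisors F).comap (Int.castRingHom F)
  have hM : M ≤ nonZeroDivisors ℤ := by
    intro n hn
    rw [mem_nonZeroDivisors_iff_ne_zero]
    rintro rfl
    simp [M] at hn
  have hle : ZInv S ≤ Localization.subalgebra.ofField ℚ M hM := by
    refine Algebra.adjoin_le ?_
    rintro _ ⟨p, hp, rfl⟩
    exact ⟨1, p, by simpa [M] using hF p hp, by simp⟩
  let f : Localization.subalgebra.ofField ℚ M hM →+* F :=
    IsLocalization.lift (M := M) (g := Int.castRingHom F) fun y ↦
      isUnit_iff_ne_zero.mpr (nonZeroDivisors.ne_zero y.2)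
  exact ⟨f.comp (Subalgebra.inclusion hle).toRingHom⟩

/-- The diagram of the rings `ℤ[S⁻¹]`. -/
noncomputable def ringFunctor : Finset Nat.Primes ⥤ CommRingCat.{0} where
  obj S := .of (ZInv S)
  map h := CommRingCat.ofHom (Subalgebra.inclusion (mono (leOfHom h))).toRingHom
  map_id _ := rfl
  map_comp _ _ := rfl

/-- The cocone of the inclusions `ℤ[S⁻¹] → ℚ`. -/
noncomputable def ringCocone : Limits.Cocone ringFunctor where
  pt := .of ℚ
  ι :=
    { app S := CommRingCat.ofHom (algebraMap (ZInv S) ℚ)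
      naturality _ _ _ := rfl }

/-- `ℚ` is the colimit of the rings `ℤ[S⁻¹]`. -/
noncomputable def isColimitRingCocone : Limits.IsColimit ringCocone := by
  -- The forgetful functor preserves filtered colimits and reflects isomorphisms, so the colimit can
  -- be checked on sets, where it is a directed union.
  have : Limits.ReflectsFilteredColimits (forget CommRingCat.{0}) :=
    ⟨fun _ ↦ Limits.reflectsColimitsOfShape_of_reflectsIsomorphisms⟩
  refine Limits.ReflectsColimit.reflects (F := forget CommRingCat.{0}) ?_ |>.some
  refine Limits.Types.FilteredColimit.isColimitOf' _ _ ?_ ?_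
  · intro r
    obtain ⟨S, hS⟩ := exists_mem r
    exact ⟨S, ⟨r, hS⟩, rfl⟩
  · intro S x y h
    exact ⟨S, 𝟙 _, congrArg _ (Subtype.ext h)⟩

/-- The diagram of the schemes `Spec ℤ[S⁻¹]`. -/
noncomputable def specFunctor : (Finset Nat.Primes)ᵒᵖ ⥤ Scheme.{0} where
  obj S := Spec (.of (ZInv S.unop))
  map h := Spec.map (CommRingCat.ofHom (Subalgebra.inclusion (mono (leOfHom h.unop))).toRingHom)
  map_id S := Scheme.Spec.map_id (.op (.of (ZInv S.unop)))
  map_comp f g := Spec.map_comp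
    (CommRingCat.ofHom (Subalgebra.inclusion (mono (leOfHom g.unop))).toRingHom)
    (CommRingCat.ofHom (Subalgebra.inclusion (mono (leOfHom f.unop))).toRingHom)

/-- The cone of the morphisms `Spec ℚ ⟶ Spec ℤ[S⁻¹]`. -/
noncomputable def specCone : Limits.Cone specFunctor where
  pt := Spec (.of ℚ)
  π :=
    { app S := Spec.map (CommRingCat.ofHom (algebraMap (ZInv S.unop) ℚ))
      naturality S _ h := (Category.id_comp _).trans (Spec.map_comp
        (CommRingCat.ofHom (Subalgebra.inclusion (mono (leOfHom h.unop))).toRingHom)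
        (CommRingCat.ofHom (algebraMap (ZInv S.unop) ℚ))) }

/-- `Spec ℚ` is the limit of the schemes `Spec ℤ[S⁻¹]`. -/
noncomputable def isLimitSpecCone : Limits.IsLimit specCone :=
  (Limits.isLimitOfPreserves Scheme.Spec isColimitRingCocone.op :
    Limits.IsLimit (Scheme.Spec.mapCone ringCocone.op))

instance epi (S : Finset Nat.Primes) : Epi (CommRingCat.ofHom (algebraMap ℤ (ZInv S))) where
  left_cancellation _ _ _ := by
    ext1
    exact Subsingleton.elim _ _

instance mono_specMap (S : Finset Nat.Primes) :
    Mono (Spec.map (CommRingCat.ofHom (algebraMap ℤ (ZInv S)))) :=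
  inferInstanceAs (Mono (Scheme.Spec.map (CommRingCat.ofHom (algebraMap ℤ (ZInv S))).op))

end ZInv

/-! ### Spreading out over `ℤ` -/

namespace SpreadOut

open Limits

/-- The morphism `Spec ℚ ⟶ Spec ℤ`. -/
noncomputable abbrev specQ : Spec (.of ℚ) ⟶ Spec (.of ℤ) :=
  Spec.map (CommRingCat.ofHom (algebraMap ℤ ℚ))

/-- The morphism `Spec ℤ[S⁻¹] ⟶ Spec ℤ`. -/
noncomputable abbrev specZInv (S : Finset Nat.Primes) : Spec (.of (ZInv S)) ⟶ Spec (.of ℤ) :=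
  Spec.map (CommRingCat.ofHom (algebraMap ℤ (ZInv S)))

/-- The morphism `Spec ℚ ⟶ Spec ℤ[S⁻¹]`. -/
noncomputable abbrev specQToZInv (S : Finset Nat.Primes) : Spec (.of ℚ) ⟶ Spec (.of (ZInv S)) :=
  Spec.map (CommRingCat.ofHom (algebraMap (ZInv S) ℚ))

theorem hom_specZ_ext {X : Scheme.{0}} (f g : X ⟶ Spec (.of ℤ)) : f = g :=
  specZIsTerminal.hom_ext f g

variable {𝒳 𝒴 X : Scheme.{0}} (π : 𝒳 ⟶ Spec (.of ℤ))

/-- The diagram of the schemes `𝒳 × Spec ℤ[S⁻¹]`. -/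
noncomputable def diagram : (Finset Nat.Primes)ᵒᵖ ⥤ Scheme.{0} where
  obj S := pullback π (specZInv S.unop)
  map {S T} h := pullback.lift (pullback.fst _ _)
    (pullback.snd π (specZInv S.unop) ≫ ZInv.specFunctor.map h) (hom_specZ_ext _ _)
  map_id S := pullback.hom_ext ((pullback.lift_fst _ _ _).trans (Category.id_comp _).symm) <|
    (pullback.lift_snd _ _ _).trans <| by
      rw [ZInv.specFunctor.map_id]
      exact (Category.comp_id _).trans (Category.id_comp _).symm
  map_comp f g := pullback.hom_ext
    ((pullback.lift_fst _ _ _).trans <| .symm <| (Category.assoc _ _ _).trans <|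
      (congrArg _ (pullback.lift_fst _ _ _)).trans (pullback.lift_fst _ _ _))
    ((pullback.lift_snd _ _ _).trans <| .symm <| (Category.assoc _ _ _).trans <|
      (congrArg _ (pullback.lift_snd _ _ _)).trans <| (Category.assoc _ _ _).symm.trans <|
      (congrArg (· ≫ ZInv.specFunctor.map g) (pullback.lift_snd _ _ _)).trans <|
      (Category.assoc _ _ _).trans <| congrArg _ (ZInv.specFunctor.map_comp f g).symm)

/-- The projection `𝒳 × Spec ℤ[S⁻¹] ⟶ 𝒳`. -/
noncomputable def proj (S : (Finset Nat.Primes)ᵒᵖ) : (diagram π).obj S ⟶ 𝒳 :=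
  pullback.fst π (specZInv S.unop)

/-- The projection `𝒳 × Spec ℤ[S⁻¹] ⟶ Spec ℤ[S⁻¹]`. -/
noncomputable def diagramToSpec : diagram π ⟶ ZInv.specFunctor where
  app S := pullback.snd π (specZInv S.unop)
  naturality _ _ _ := pullback.lift_snd _ _ _

theorem isPullback_proj (S : (Finset Nat.Primes)ᵒᵖ) :
    IsPullback (proj π S) ((diagramToSpec π).app S) π (specZInv S.unop) :=
  IsPullback.of_hasPullback _ _

theorem map_proj {S T : (Finset Nat.Primes)ᵒᵖ} (h : S ⟶ T) :
    (diagram π).map h ≫ proj π T = proj π S :=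
  pullback.lift_fst _ _ _

instance (S : (Finset Nat.Primes)ᵒᵖ) : Mono (proj π S) :=
  inferInstanceAs (Mono (pullback.fst π (specZInv S.unop)))

instance (S : (Finset Nat.Primes)ᵒᵖ) : IsAffineHom (proj π S) :=
  MorphismProperty.of_isPullback (isPullback_proj π S).flip
    (inferInstanceAs (IsAffineHom (specZInv S.unop)))

/-- Affine transition maps are what the approximation theorems for limits of schemes require. -/
instance {S T : (Finset Nat.Primes)ᵒᵖ} (h : S ⟶ T) : IsAffineHom ((diagram π).map h) := by
  have : IsAffineHom ((diagram π).map h ≫ proj π T) := by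
    rw [map_proj]
    infer_instance
  exact .of_comp _ (proj π T)

instance [QuasiCompact π] (S : (Finset Nat.Primes)ᵒᵖ) : CompactSpace ((diagram π).obj S) := by
  have : CompactSpace 𝒳 := QuasiCompact.compactSpace_of_compactSpace π
  exact QuasiCompact.compactSpace_of_compactSpace (proj π S)

instance [QuasiSeparated π] (S : (Finset Nat.Primes)ᵒᵖ) :
    QuasiSeparatedSpace ((diagram π).obj S) := by
  have : QuasiSeparatedSpace 𝒳 := quasiSeparatedSpace_of_quasiSeparated π
  exact quasiSeparatedSpace_of_quasiSeparated (proj π S)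

variable {π} {i : X ⟶ 𝒳} {s : X ⟶ Spec (.of ℚ)} (hi : IsPullback i s π specQ)

/-- The morphism from the generic fiber to the diagram. -/
noncomputable def toDiagram (π : 𝒳 ⟶ Spec (.of ℤ)) (i : X ⟶ 𝒳) (s : X ⟶ Spec (.of ℚ))
    (S : (Finset Nat.Primes)ᵒᵖ) : X ⟶ (diagram π).obj S :=
  pullback.lift i (s ≫ specQToZInv S.unop) (hom_specZ_ext _ _)

theorem toDiagram_proj (S : (Finset Nat.Primes)ᵒᵖ) : toDiagram π i s S ≫ proj π S = i :=
  pullback.lift_fst _ _ _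

theorem toDiagram_snd (S : (Finset Nat.Primes)ᵒᵖ) :
    toDiagram π i s S ≫ (diagramToSpec π).app S = s ≫ specQToZInv S.unop :=
  pullback.lift_snd _ _ _

theorem toDiagram_map {S T : (Finset Nat.Primes)ᵒᵖ} (h : S ⟶ T) :
    toDiagram π i s S ≫ (diagram π).map h = toDiagram π i s T := by
  rw [← cancel_mono (proj π T), Category.assoc, map_proj, toDiagram_proj, toDiagram_proj]

/-- The cone over the diagram with vertex the generic fiber. -/
noncomputable def cone (π : 𝒳 ⟶ Spec (.of ℤ)) (i : X ⟶ 𝒳) (s : X ⟶ Spec (.of ℚ)) :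
    Cone (diagram π) where
  pt := X
  π :=
    { app S := toDiagram π i s S
      naturality _ _ h := (Category.id_comp _).trans (toDiagram_map h).symm }

include hi in
theorem isPullback_toDiagram (S : (Finset Nat.Primes)ᵒᵖ) :
    IsPullback (toDiagram π i s S) s ((diagramToSpec π).app S) (specQToZInv S.unop) := by
  have h : IsPullback (toDiagram π i s S ≫ proj π S) s π
      (specQToZInv S.unop ≫ specZInv S.unop) := by
    rw [toDiagram_proj, hom_specZ_ext (specQToZInv S.unop ≫ specZInv S.unop) specQ]
    exact hi
  exact IsPullback.of_right h (toDiagram_snd S) (isPullback_proj π S)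

include hi in
/-- The generic fiber is the limit of the diagram. -/
noncomputable def isLimitCone : IsLimit (cone π i s) :=
  -- Base change along a connected diagram carries the limit `Spec ℚ` of the schemes `Spec ℤ[S⁻¹]`
  -- to the limit of the diagram.
  isLimitOfIsPullbackOfIsConnected (diagramToSpec π) (cone π i s) ZInv.specCone
    { hom := s, w := fun S ↦ (isPullback_toDiagram hi S).w.symm }
    (fun S ↦ isPullback_toDiagram hi S) ZInv.isLimitSpecCone

/-- The structure morphisms of the diagram over `Spec ℤ`. -/
noncomputable def diagramToSpecZ (π : 𝒳 ⟶ Spec (.of ℤ)) :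
    diagram π ⟶ (Functor.const _).obj (Spec (.of ℤ)) where
  app _ := specZIsTerminal.from _
  naturality _ _ _ := hom_specZ_ext _ _

include hi in
-- As `ℤ` is Noetherian, `𝒴` is locally of finite presentation, so a morphism from the limit to `𝒴`
-- is defined after inverting finitely many primes.
theorem exists_toDiagram_comp_eq [QuasiCompact π] [QuasiSeparated π] (ρ : 𝒴 ⟶ Spec (.of ℤ))
    [LocallyOfFiniteType ρ] (a : X ⟶ 𝒴) :
    ∃ (S : (Finset Nat.Primes)ᵒᵖ) (g : (diagram π).obj S ⟶ 𝒴),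
      toDiagram π i s S ≫ g = a := by
  have : LocallyOfFinitePresentation ρ :=
    LocallyOfFinitePresentation.iff_locallyOfFiniteType.mpr ‹_›
  obtain ⟨S, g, hg, -⟩ := Scheme.exists_π_app_comp_eq_of_locallyOfFinitePresentation (diagram π)
    (diagramToSpecZ π) ρ _ (isLimitCone hi) a (by ext1; ext1; exact hom_specZ_ext _ _)
  exact ⟨S, g, hg⟩

include hi in
theorem exists_map_comp_eq [QuasiCompact π] (ρ : 𝒴 ⟶ Spec (.of ℤ))
    [LocallyOfFiniteType ρ] {S : (Finset Nat.Primes)ᵒᵖ} (a b : (diagram π).obj S ⟶ 𝒴)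
    (h : toDiagram π i s S ≫ a = toDiagram π i s S ≫ b) :
    ∃ (T : (Finset Nat.Primes)ᵒᵖ) (f : T ⟶ S), (diagram π).map f ≫ a = (diagram π).map f ≫ b :=
  Scheme.exists_hom_comp_eq_comp_of_locallyOfFiniteType (diagram π) (diagramToSpecZ π) ρ _
    (isLimitCone hi) a b (hom_specZ_ext _ _) (hom_specZ_ext _ _) h

theorem exists_lift (π : 𝒳 ⟶ Spec (.of ℤ)) {S : (Finset Nat.Primes)ᵒᵖ} {F : Type} [Field F]
    (hF : ∀ p ∈ S.unop, ((p : ℕ) : F) ≠ 0) (x : Spec (.of F) ⟶ 𝒳) :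
    ∃ y : Spec (.of F) ⟶ (diagram π).obj S, y ≫ proj π S = x := by
  obtain ⟨f⟩ := ZInv.nonempty_ringHom hF
  exact ⟨pullback.lift x (Spec.map (CommRingCat.ofHom f)) (hom_specZ_ext _ _),
    pullback.lift_fst _ _ _⟩

variable {ρ : 𝒴 ⟶ Spec (.of ℤ)} {j : X ⟶ 𝒴} (hj : IsPullback j s ρ specQ)

include hi hj in
-- The identity of the generic fiber spreads out to morphisms in both directions, mutually inverse
-- after more primes are inverted. Over a field in which these primes are nonzero, every point lifts
-- to the localized models, uniquely because `proj` is a monomorphism.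
theorem nonempty_equiv_specPoints [QuasiCompact π] [QuasiSeparated π] [LocallyOfFiniteType π]
    [QuasiCompact ρ] [QuasiSeparated ρ] [LocallyOfFiniteType ρ] :
    ∃ S : Finset Nat.Primes, ∀ (F : Type) [Field F], (∀ p ∈ S, ((p : ℕ) : F) ≠ 0) →
      Nonempty ((Spec (.of F) ⟶ 𝒳) ≃ (Spec (.of F) ⟶ 𝒴)) := by
  obtain ⟨S₁, g₁, hg₁⟩ := exists_toDiagram_comp_eq hi ρ j
  obtain ⟨S₂, h₂, hh₂⟩ := exists_toDiagram_comp_eq hj π i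
  obtain ⟨S, f₁, f₂, -⟩ := IsCofilteredOrEmpty.cone_objs S₁ S₂
  let g := (diagram π).map f₁ ≫ g₁
  let h := (diagram ρ).map f₂ ≫ h₂
  have hg : toDiagram π i s S ≫ g = j := by
    simp only [g]
    rw [← hg₁, ← toDiagram_map f₁, Category.assoc]
  have hh : toDiagram ρ j s S ≫ h = i := by
    simp only [h]
    rw [← hh₂, ← toDiagram_map f₂, Category.assoc]
  let g' : (diagram π).obj S ⟶ (diagram ρ).obj S :=
    pullback.lift g (pullback.snd _ _) (hom_specZ_ext _ _)
  let h' : (diagram ρ).obj S ⟶ (diagram π).obj S :=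
    pullback.lift h (pullback.snd _ _) (hom_specZ_ext _ _)
  have hg'p : g' ≫ proj ρ S = g := pullback.lift_fst _ _ _
  have hh'p : h' ≫ proj π S = h := pullback.lift_fst _ _ _
  have hg' : toDiagram π i s S ≫ g' = toDiagram ρ j s S := by
    rw [← cancel_mono (proj ρ S), Category.assoc, hg'p, hg, toDiagram_proj]
  have hh' : toDiagram ρ j s S ≫ h' = toDiagram π i s S := by
    rw [← cancel_mono (proj π S), Category.assoc, hh'p, hh, toDiagram_proj]
  -- The round trip agrees with the projection on the generic fiber, hence at some finite stage.
  obtain ⟨T₁, e₁, he₁⟩ := exists_map_comp_eq hi π (g' ≫ h) (proj π S) (by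
    rw [reassoc_of% hg', hh, toDiagram_proj])
  obtain ⟨T₂, e₂, he₂⟩ := exists_map_comp_eq hj ρ (h' ≫ g) (proj ρ S) (by
    rw [reassoc_of% hh', hg, toDiagram_proj])
  refine ⟨T₁.unop ∪ T₂.unop, fun F _ hF ↦ ?_⟩
  have hF₁ : ∀ p ∈ T₁.unop, ((p : ℕ) : F) ≠ 0 := fun p hp ↦ hF p (Finset.mem_union_left _ hp)
  have hF₂ : ∀ p ∈ T₂.unop, ((p : ℕ) : F) ≠ 0 := fun p hp ↦ hF p (Finset.mem_union_right _ hp)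
  choose l hl using exists_lift (F := F) π hF₁
  choose m hm using exists_lift (F := F) ρ hF₂
  refine ⟨⟨fun x ↦ l x ≫ (diagram π).map e₁ ≫ g, fun y ↦ m y ≫ (diagram ρ).map e₂ ≫ h, ?_, ?_⟩⟩
  · intro x
    have : m (l x ≫ (diagram π).map e₁ ≫ g) ≫ (diagram ρ).map e₂ =
        l x ≫ (diagram π).map e₁ ≫ g' := by
      rw [← cancel_mono (proj ρ S)]
      simp only [Category.assoc, map_proj, hm, hg'p]
    simp only [reassoc_of% this, he₁, map_proj, hl]
  · intro y
    have : l (m y ≫ (diagram ρ).map e₂ ≫ h) ≫ (diagram π).map e₁ =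
        m y ≫ (diagram ρ).map e₂ ≫ h' := by
      rw [← cancel_mono (proj π S)]
      simp only [Category.assoc, map_proj, hl, hh'p]
    simp only [reassoc_of% this, he₂, map_proj, hm]

end SpreadOut

/-! ### Generic fibers and local criteria for pullback squares -/

namespace SpreadOut

open Limits

theorem isPullback_comp_mono {C : Type*} [Category C] {P X Y Z T : C} {p : P ⟶ X} {q : P ⟶ Y}
    {f : X ⟶ Z} {g : Y ⟶ Z} (h : IsPullback p q f g) (m : Z ⟶ T) [Mono m] :
    IsPullback p q (f ≫ m) (g ≫ m) :=
  ⟨⟨by simp only [← Category.assoc, h.w]⟩,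
    ⟨PullbackCone.IsLimit.mk _
      (fun s ↦ h.lift s.fst s.snd ((cancel_mono m).mp (by simpa using s.condition)))
      (fun _ ↦ h.lift_fst _ _ _) (fun _ ↦ h.lift_snd _ _ _)
      (fun _ _ h₁ h₂ ↦ h.hom_ext (h₁.trans (h.lift_fst _ _ _).symm)
        (h₂.trans (h.lift_snd _ _ _).symm))⟩⟩

theorem isIso_of_isPullback_comp {C : Type*} [Category C] {P Q X Y Z : C} {p : P ⟶ X} {q : P ⟶ Y}
    {f : X ⟶ Z} {g : Y ⟶ Z} (h : IsPullback p q f g) (l : Q ⟶ P)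
    (h' : IsPullback (l ≫ p) (l ≫ q) f g) : IsIso l :=
  ⟨h'.lift p q h.w, h'.hom_ext (by simp) (by simp), h.hom_ext (by simp) (by simp)⟩

/-- A square of schemes is a pullback square if it is so locally on the lower left corner. -/
theorem isPullback_of_openCover {P X Y Z : Scheme.{0}} {p : P ⟶ X} {q : P ⟶ Y}
    {f : X ⟶ Z} {g : Y ⟶ Z} (w : p ≫ f = q ≫ g) (𝒰 : X.OpenCover)
    {U : 𝒰.I₀ → Scheme.{0}} (r : ∀ i, U i ⟶ 𝒰.X i) (j : ∀ i, U i ⟶ P)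
    (h : ∀ i, IsPullback (j i) (r i) p (𝒰.f i))
    (h' : ∀ i, IsPullback (r i) (j i ≫ q) (𝒰.f i ≫ f) g) :
    IsPullback p q f g := by
  let l : P ⟶ pullback f g := pullback.lift p q w
  have hp : l ≫ pullback.fst f g = p := pullback.lift_fst _ _ _
  have hq : l ≫ pullback.snd f g = q := pullback.lift_snd _ _ _
  suffices hl : IsIso l by
    exact IsPullback.of_iso_pullback ⟨w⟩ (asIso l) hp hq
  let 𝒱 := 𝒰.pullback₁ (pullback.fst f g)
  refine (IsZariskiLocalAtTarget.iff_of_openCover (P := .isomorphisms Scheme) 𝒱).mpr fun i ↦ ?_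
  change IsIso (pullback.snd l (pullback.fst (pullback.fst f g) (𝒰.f i)))
  have h₁ := IsPullback.of_hasPullback (pullback.fst f g) (𝒰.f i)
  have h₂ := (h₁.paste_horiz (IsPullback.of_hasPullback f g).flip).flip
  let l' := h₁.lift (j i ≫ l) (r i) (by rw [Category.assoc, hp, (h i).w])
  have hl₁ : l' ≫ pullback.fst _ _ = j i ≫ l := h₁.lift_fst _ _ _
  have hl₂ : l' ≫ pullback.snd _ _ = r i := h₁.lift_snd _ _ _
  have : IsIso l' := by
    refine isIso_of_isPullback_comp h₂ l' ?_
    rw [hl₂, ← Category.assoc, hl₁, Category.assoc, hq]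
    exact h' i
  have h₃ : IsPullback (j i) l' l (pullback.fst (pullback.fst f g) (𝒰.f i)) := by
    refine IsPullback.of_bot ?_ hl₁.symm h₁
    rw [hl₂, hp]
    exact h i
  rw [← h₃.isoPullback_inv_snd]
  infer_instance

variable {X : Scheme.{0}} {s : X ⟶ Spec (.of ℚ)}

theorem exists_isPullback_of_isGenericFiber {R : Type} [CommRing R] [Algebra R ℚ]
    {𝒳 : Scheme.{0}} {π : 𝒳 ⟶ Spec (.of R)} (h : IsGenericFiber π s) :
    ∃ i : X ⟶ 𝒳, IsPullback i s π (Spec.map (CommRingCat.ofHom (algebraMap R ℚ))) := by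
  obtain ⟨e, he⟩ := h
  have hs : s = e.inv ≫ pullback.snd _ _ := by rw [← he, e.inv_hom_id_assoc]
  refine ⟨e.inv ≫ pullback.fst _ _, IsPullback.of_iso_pullback ⟨?_⟩ e.symm rfl hs.symm⟩
  rw [hs, Category.assoc, Category.assoc, pullback.condition]

theorem isGenericFiber_of_isPullback {R : Type} [CommRing R] [Algebra R ℚ]
    {𝒳 : Scheme.{0}} {π : 𝒳 ⟶ Spec (.of R)} {i : X ⟶ 𝒳}
    (h : IsPullback i s π (Spec.map (CommRingCat.ofHom (algebraMap R ℚ)))) :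
    IsGenericFiber π s :=
  ⟨h.isoPullback.symm, h.isoPullback_inv_snd⟩

/-- A model over `ℤ[S⁻¹]` is also a model over `ℤ`, because `Spec ℤ[S⁻¹] ⟶ Spec ℤ` is a
monomorphism. -/
theorem isPullback_comp_specZInv {S : Finset Nat.Primes} {𝒳 : Scheme.{0}}
    {π : 𝒳 ⟶ Spec (.of (ZInv S))} {i : X ⟶ 𝒳}
    (h : IsPullback i s π (Spec.map (CommRingCat.ofHom (algebraMap (ZInv S) ℚ)))) :
    IsPullback i s (π ≫ specZInv S) specQ := by
  rw [hom_specZ_ext specQ (specQToZInv S ≫ specZInv S)]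
  exact isPullback_comp_mono h _

end SpreadOut

/-! ### Base change of `Proj` along a localization -/

namespace ProjLocalization

open HomogeneousLocalization

variable {R K A B : Type} [CommRing R] [CommRing K] [CommRing A] [CommRing B] [Algebra R K]
  [Algebra R A] [Algebra K B] {𝒜 : ℕ → Submodule R A} {ℬ : ℕ → Submodule K B}
  [GradedAlgebra 𝒜] [GradedAlgebra ℬ]

/-- A graded homomorphism exhibiting the graded `K`-algebra `B` as the localization of the
graded `R`-algebra `A` at a submonoid of `R`. -/
structure IsGradedLocalization (M : Submonoid R) (φ : 𝒜 →+*ᵍ ℬ) : Prop where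
  map_algebraMap : ∀ r : R, φ (algebraMap R A r) = algebraMap K B (algebraMap R K r)
  exists_map_eq_smul : ∀ n, ∀ b ∈ ℬ n, ∃ m ∈ M, ∃ a ∈ 𝒜 n, φ a = algebraMap R K m • b
  exists_smul_eq_zero : ∀ a, φ a = 0 → ∃ m ∈ M, m • a = 0

variable {M : Submonoid R} [IsLocalization M K] {φ : 𝒜 →+*ᵍ ℬ} (hφ : IsGradedLocalization M φ)

/-- The homomorphism from the base ring to the degree zero part of a homogeneous localization. -/
noncomputable def toAway (𝒜 : ℕ → Submodule R A) [GradedAlgebra 𝒜] (f : A) : R →+* Away 𝒜 f :=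
  (fromZeroRingHom 𝒜 (Submonoid.powers f)).comp (algebraMap R (𝒜 0))

theorem val_toAway (f : A) (r : R) :
    (toAway 𝒜 f r).val = algebraMap A (Localization.Away f) (algebraMap R A r) :=
  Localization.mk_one_eq_algebraMap (algebraMap R A r)

include hφ

/-- This makes the induced morphism of `Proj` defined everywhere. A denominator from `M` is a unit
of `K`, so every element of positive degree is a multiple of an image. -/
theorem irrelevant_le_map :
    HomogeneousIdeal.irrelevant ℬ ≤ (HomogeneousIdeal.irrelevant 𝒜).map φ := by
  refine (HomogeneousIdeal.irrelevant_le ℬ).mpr fun n hn b hb ↦ ?_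
  obtain ⟨m, hm, a, ha, hab⟩ := hφ.exists_map_eq_smul n b hb
  obtain ⟨u, hu⟩ := (IsLocalization.map_units K ⟨m, hm⟩)
  have hb' : b = (↑u⁻¹ : K) • φ a := by
    rw [hab, ← hu, smul_smul, Units.inv_mul, one_smul]
  rw [hb', Algebra.smul_def]
  refine Ideal.mul_mem_left _ _ (Ideal.mem_map_of_mem φ ?_)
  exact HomogeneousIdeal.mem_irrelevant_of_mem 𝒜 hn ha

omit [IsLocalization M K] in
theorem awayMap_comp_toAway (f : A) :
    (Away.map φ f).comp (toAway 𝒜 f) = (toAway ℬ (φ f)).comp (algebraMap R K) := by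
  ext r
  have h : (Away.map φ f (toAway 𝒜 f r)).val =
      Localization.mk (φ (algebraMap R A r)) ⟨φ 1, (⟨0, by simp⟩ : φ 1 ∈ Submonoid.powers (φ f))⟩ := rfl
  rw [RingHom.comp_apply, RingHom.comp_apply, h, val_toAway, ← hφ.map_algebraMap,
    ← Localization.mk_one_eq_algebraMap]
  congr 2
  exact map_one φ

/-- Clearing the denominator of `b` in `b / φ(f)ⁿ` gives surjectivity up to `M`; if `a / fⁿ` maps to
zero, then `φ` kills some `f^k a`, which an element of `M` therefore kills. -/
theorem isLocalization_awayMap {d : ℕ} {f : A} (hf : f ∈ 𝒜 d) :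
    letI := (Away.map φ f).toAlgebra
    IsLocalization (M.map (toAway 𝒜 f)) (Away ℬ (φ f)) := by
  let := (Away.map φ f).toAlgebra
  have key (r : R) : Away.map φ f (toAway 𝒜 f r) = toAway ℬ (φ f) (algebraMap R K r) :=
    DFunLike.congr_fun (awayMap_comp_toAway hφ f) r
  constructor
  constructor
  · rintro ⟨_, m, hm, rfl⟩
    change IsUnit (Away.map φ f (toAway 𝒜 f m))
    rw [key]
    exact (IsLocalization.map_units K ⟨m, hm⟩).map _
  · intro z
    obtain ⟨n, b, hb, rfl⟩ := Away.mk_surjective ℬ (φ.map_mem hf) z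
    obtain ⟨m, hm, a, ha, hab⟩ := hφ.exists_map_eq_smul _ b hb
    refine ⟨⟨Away.mk 𝒜 hf n a ha, ⟨_, m, hm, rfl⟩⟩, ?_⟩
    change _ * Away.map φ f (toAway 𝒜 f m) = Away.map φ f _
    rw [key, Away.map_mk]
    apply val_injective
    rw [val_mul, val_toAway, Away.val_mk, Away.val_mk, ← Localization.mk_one_eq_algebraMap,
      Localization.mk_mul]
    congr 1
    · rw [hab, Algebra.smul_def, mul_comm]
    · exact mul_one _
  · intro x y hxy
    replace hxy : Away.map φ f (x - y) = 0 := by rw [map_sub]; exact sub_eq_zero.mpr hxy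
    suffices h : ∃ m ∈ M, toAway 𝒜 f m * (x - y) = 0 by
      obtain ⟨m, hm, h⟩ := h
      exact ⟨⟨_, m, hm, rfl⟩, by rwa [mul_sub, sub_eq_zero] at h⟩
    obtain ⟨n, a, ha, hz⟩ := Away.mk_surjective 𝒜 hf (x - y)
    rw [← hz] at hxy ⊢
    rw [Away.map_mk] at hxy
    have := congrArg val hxy
    rw [Away.val_mk, val_zero, Localization.mk_eq_mk', IsLocalization.mk'_eq_zero_iff] at this
    obtain ⟨⟨_, k, rfl⟩, hk⟩ := this
    obtain ⟨m, hm, hma⟩ := hφ.exists_smul_eq_zero (f ^ k * a) (by simpa using hk)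
    refine ⟨m, hm, val_injective _ ?_⟩
    rw [val_mul, val_toAway, Away.val_mk, val_zero, ← Localization.mk_one_eq_algebraMap,
      Localization.mk_mul, Localization.mk_eq_mk', IsLocalization.mk'_eq_zero_iff]
    refine ⟨⟨_, k, rfl⟩, ?_⟩
    rw [← hma, Algebra.smul_def]
    ring

omit hφ in
/-- The structure morphism of `Proj` of a graded algebra. -/
noncomputable def toSpecBase (𝒜 : ℕ → Submodule R A) [GradedAlgebra 𝒜] : Proj 𝒜 ⟶ Spec (.of R) :=
  Proj.toSpecZero 𝒜 ≫ Spec.map (CommRingCat.ofHom (algebraMap R (𝒜 0)))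

theorem isPullback_awayι {d : ℕ} {f : A} (hf : f ∈ 𝒜 d) (hd : 0 < d) :
    IsPullback (Proj.awayι ℬ (φ f) (φ.map_mem hf) hd)
      (Spec.map (CommRingCat.ofHom (Away.map φ f)))
      (Proj.map φ (irrelevant_le_map hφ)) (Proj.awayι 𝒜 f hf hd) := by
  refine (IsOpenImmersion.isPullback _ _ _ _ (Proj.awayι_comp_map φ _ hd f hf) ?_).flip
  rw [Proj.opensRange_awayι, Proj.opensRange_awayι, Proj.map_preimage_basicOpen]

theorem isPullback_specMap_awayMap {d : ℕ} {f : A} (hf : f ∈ 𝒜 d) :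
    IsPullback (Spec.map (CommRingCat.ofHom (Away.map φ f)))
      (Spec.map (CommRingCat.ofHom (toAway ℬ (φ f))))
      (Spec.map (CommRingCat.ofHom (toAway 𝒜 f)))
      (Spec.map (CommRingCat.ofHom (algebraMap R K))) := by
  let := (Away.map φ f).toAlgebra
  have := isLocalization_awayMap hφ hf
  exact isPullback_SpecMap_of_isPushout _ _ _ _ (CommRingCat.isPushout_of_isLocalization
    (toAway 𝒜 f) (toAway ℬ (φ f)) (awayMap_comp_toAway hφ f).symm M)

omit hφ in
theorem awayι_toSpecBase {d : ℕ} {f : A} (hf : f ∈ 𝒜 d) (hd : 0 < d) :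
    Proj.awayι 𝒜 f hf hd ≫ toSpecBase 𝒜 = Spec.map (CommRingCat.ofHom (toAway 𝒜 f)) := by
  rw [toSpecBase, Proj.awayι_toSpecZero_assoc, ← Spec.map_comp]
  rfl

/-- `Proj` commutes with localization of the base ring. -/
theorem isPullback_map :
    IsPullback (Proj.map φ (irrelevant_le_map hφ)) (toSpecBase ℬ) (toSpecBase 𝒜)
      (Spec.map (CommRingCat.ofHom (algebraMap R K))) := by
  -- On each chart `D₊(f)` the square is `Spec` of a localization pushout.
  refine SpreadOut.isPullback_of_openCover ?_ (Proj.affineOpenCover 𝒜).openCover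
    (U := fun s ↦ Spec (.of (Away ℬ (φ s.2))))
    (fun s ↦ Spec.map (CommRingCat.ofHom (Away.map φ s.2.1)))
    (fun s ↦ Proj.awayι ℬ (φ s.2) (φ.map_mem s.2.2) s.1.2)
    (fun s ↦ isPullback_awayι hφ s.2.2 s.1.2) (fun s ↦ ?_)
  · refine (Proj.mapAffineOpenCover φ (irrelevant_le_map hφ)).openCover.hom_ext _ _ fun s ↦ ?_
    have h {d : ℕ} {f : A} (hf : f ∈ 𝒜 d) (hd : 0 < d) :
        Proj.awayι ℬ (φ f) (φ.map_mem hf) hd ≫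
            Proj.map φ (irrelevant_le_map hφ) ≫ toSpecBase 𝒜 =
          Proj.awayι ℬ (φ f) (φ.map_mem hf) hd ≫ toSpecBase ℬ ≫
            Spec.map (CommRingCat.ofHom (algebraMap R K)) := by
      rw [Proj.awayι_comp_map_assoc φ _ hd _ hf, awayι_toSpecBase,
        reassoc_of% awayι_toSpecBase (f := φ f) (φ.map_mem hf) hd]
      exact (isPullback_specMap_awayMap hφ hf).w
    exact h s.2.2 s.1.2
  · have := isPullback_specMap_awayMap hφ s.2.2
    rw [← awayι_toSpecBase s.2.2 s.1.2,
      ← awayι_toSpecBase (φ.map_mem s.2.2) s.1.2] at this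
    exact this

end ProjLocalization

/-! ### Models of projective Weierstrass schemes -/

namespace WeierstrassCurve

variable {R K : Type} [CommRing R] [CommRing K] (W : WeierstrassCurve R)

theorem toProjective_map_polynomial (f : R →+* K) :
    (W.map f).toProjective.polynomial = MvPolynomial.map f W.toProjective.polynomial :=
  Projective.map_polynomial W.toProjective f

/-- The graded homomorphism of homogeneous coordinate rings induced by a change of rings. -/
noncomputable def homogCoordMap (f : R →+* K) :
    W.homogCoordGrading →+*ᵍ (W.map f).homogCoordGrading where
  __ := Ideal.quotientMap (Ideal.span {(W.map f).toProjective.polynomial}) (MvPolynomial.map f) (by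
    rw [Ideal.span_singleton_le_iff_mem, Ideal.mem_comap, ← toProjective_map_polynomial]
    exact Ideal.mem_span_singleton_self _)
  map_mem := by
    rintro n _ ⟨P, hP, rfl⟩
    exact (W.map f).mk_mem_homogCoordGrading (MvPolynomial.IsHomogeneous.map hP f)

theorem homogCoordMap_mk (f : R →+* K) (P : MvPolynomial (Fin 3) R) :
    W.homogCoordMap f (Ideal.Quotient.mk _ P) = Ideal.Quotient.mk _ (MvPolynomial.map f P) :=
  rfl

variable [Algebra R K]

theorem exists_map_eq_smul {σ : Type*} (M : Submonoid R) [IsLocalization M K]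
    (P : MvPolynomial σ K) :
    ∃ m ∈ M, ∃ Q : MvPolynomial σ R,
      MvPolynomial.map (algebraMap R K) Q = MvPolynomial.C (algebraMap R K m) * P := by
  let := MvPolynomial.algebraMvPolynomial (σ := σ) (R := R) (S := K)
  obtain ⟨⟨Q, ⟨_, m, hm, rfl⟩⟩, h⟩ := IsLocalization.surj (M.map (MvPolynomial.C (σ := σ))) P
  refine ⟨m, hm, Q, ?_⟩
  change P * MvPolynomial.map (algebraMap R K) (MvPolynomial.C m) = _ at h
  rw [MvPolynomial.map_C, mul_comm] at h
  exact h.symm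

theorem isGradedLocalization_homogCoordMap [IsDomain R] [IsFractionRing R K] :
    ProjLocalization.IsGradedLocalization (nonZeroDivisors R)
      (W.homogCoordMap (algebraMap R K)) where
  map_algebraMap r := congrArg (Ideal.Quotient.mk _) (MvPolynomial.map_C _ _)
  exists_map_eq_smul := by
    rintro n _ ⟨P, hP, rfl⟩
    obtain ⟨m, hm, Q, hQ⟩ := exists_map_eq_smul (nonZeroDivisors R) P
    refine ⟨m, hm, Ideal.Quotient.mk _ Q, W.mk_mem_homogCoordGrading ?_, ?_⟩
    · refine MvPolynomial.IsHomogeneous.of_map (IsFractionRing.injective R K) ?_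
      rw [hQ, ← MvPolynomial.smul_eq_C_mul]
      exact Submodule.smul_mem _ _ hP
    · rw [homogCoordMap_mk, hQ, ← MvPolynomial.smul_eq_C_mul]
      rfl
  exists_smul_eq_zero := by
    rintro a ha
    obtain ⟨P, rfl⟩ := Ideal.Quotient.mk_surjective a
    rw [homogCoordMap_mk, Ideal.Quotient.eq_zero_iff_mem, Ideal.mem_span_singleton] at ha
    obtain ⟨Q, hQ⟩ := ha
    obtain ⟨m, hm, Q', hQ'⟩ := exists_map_eq_smul (nonZeroDivisors R) Q
    refine ⟨m, hm, ?_⟩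
    -- Divisibility by the cubic over `K` descends to `R` after clearing the denominators of the
    -- quotient.
    have h : MvPolynomial.C m * P = W.toProjective.polynomial * Q' := by
      refine MvPolynomial.map_injective _ (IsFractionRing.injective R K) ?_
      rw [map_mul, map_mul, hQ', hQ, MvPolynomial.map_C, toProjective_map_polynomial]
      ring
    change Ideal.Quotient.mk _ (m • P) = 0
    rw [MvPolynomial.smul_eq_C_mul, h, Ideal.Quotient.eq_zero_iff_mem]
    exact Ideal.mul_mem_right _ _ (Ideal.mem_span_singleton_self _)

theorem exists_isPullback_projScheme [IsDomain R] [IsFractionRing R K] :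
    ∃ i : (W.map (algebraMap R K)).projScheme ⟶ W.projScheme,
      IsPullback i (W.map (algebraMap R K)).projSchemeToSpec W.projSchemeToSpec
        (Spec.map (CommRingCat.ofHom (algebraMap R K))) :=
  ⟨_, ProjLocalization.isPullback_map W.isGradedLocalization_homogCoordMap⟩

/-- A form of degree zero is a constant, so `Spec` of the degree zero part is closed in `Spec R`.
Properness over `R` thus follows from properness over the degree zero part. -/
theorem algebraMap_homogCoordGrading_zero_surjective :
    Function.Surjective (algebraMap R (W.homogCoordGrading 0)) := by
  rintro ⟨_, P, hP, rfl⟩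
  have hP' : P.totalDegree = 0 := Nat.le_zero.mp (MvPolynomial.IsHomogeneous.totalDegree_le hP)
  rw [MvPolynomial.totalDegree_eq_zero_iff_eq_C] at hP'
  refine ⟨MvPolynomial.coeff 0 P, Subtype.ext ?_⟩
  exact (congrArg (Ideal.Quotient.mk _) hP').symm

instance finiteType_homogCoordRing :
    Algebra.FiniteType (W.homogCoordGrading 0) W.HomogCoordRing := by
  have : Algebra.FiniteType R W.HomogCoordRing := inferInstance
  have : IsScalarTower R (W.homogCoordGrading 0) W.HomogCoordRing :=
    ⟨fun r a b ↦ smul_mul_assoc r (a : W.HomogCoordRing) b⟩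
  exact Algebra.FiniteType.of_restrictScalars_finiteType R _ _

instance isProper_projSchemeToSpec : IsProper W.projSchemeToSpec := by
  have : IsClosedImmersion
      (Spec.map (CommRingCat.ofHom (algebraMap R (W.homogCoordGrading 0)))) :=
    IsClosedImmersion.spec_of_surjective _ W.algebraMap_homogCoordGrading_zero_surjective
  exact inferInstanceAs (IsProper (Proj.toSpecZero W.homogCoordGrading ≫ _))

end WeierstrassCurve

/-! ### Points of `Proj` with values in a field -/

namespace ProjPoint

open HomogeneousLocalization

variable {R A F : Type} [CommRing R] [CommRing A] [Algebra R A] [Field F]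
  {𝒜 : ℕ → Submodule R A} [GradedAlgebra 𝒜] {f g : A}

/-- The fraction `a / f ^ n` for `a` homogeneous of degree `n` and `f` of degree `1`. -/
def frac (hf : f ∈ 𝒜 1) (n : ℕ) (a : 𝒜 n) : Away 𝒜 f :=
  HomogeneousLocalization.mk
    ⟨n, a, ⟨f ^ n, by simpa using SetLike.pow_mem_graded n hf⟩, ⟨n, rfl⟩⟩

theorem val_frac (hf : f ∈ 𝒜 1) (n : ℕ) (a : 𝒜 n) :
    (frac hf n a).val = Localization.mk (a : A) (⟨f ^ n, n, rfl⟩ : Submonoid.powers f) :=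
  rfl

theorem frac_surjective (hf : f ∈ 𝒜 1) (z : Away 𝒜 f) : ∃ n a, frac hf n a = z := by
  obtain ⟨n, a, ha, rfl⟩ := Away.mk_surjective 𝒜 hf z
  exact ⟨n, ⟨a, by simpa using ha⟩, val_injective _ rfl⟩

/-- The homomorphism sending `a` homogeneous of degree `n` to `a / f ^ n`. -/
noncomputable def dehomogenize (hf : f ∈ 𝒜 1) : A →+* Away 𝒜 f :=
  (DirectSum.toSemiring (fun n ↦
    { toFun := frac hf n
      map_zero' := val_injective _ (by simp [val_frac, Localization.mk_zero])
      map_add' a b := val_injective _ (by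
        simp [val_frac, Localization.add_mk_self]) } : ∀ n, 𝒜 n →+ Away 𝒜 f)
    (val_injective _ (by
      change Localization.mk (1 : A) (⟨f ^ 0, 0, rfl⟩ : Submonoid.powers f) = _
      rw [val_one, ← Localization.mk_one]
      congr 2
      exact pow_zero f))
    (fun {i j} a b ↦ val_injective _ (by
      change Localization.mk ((a : A) * b) (⟨f ^ (i + j), i + j, rfl⟩ : Submonoid.powers f) =
        (frac hf i a * frac hf j b).val
      rw [val_mul, val_frac, val_frac, Localization.mk_mul]
      congr 2
      exact pow_add f i j))).comp (DirectSum.decomposeRingEquiv 𝒜).toRingHom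

theorem dehomogenize_of_mem (hf : f ∈ 𝒜 1) {n : ℕ} {a : A} (ha : a ∈ 𝒜 n) :
    dehomogenize hf a = frac hf n ⟨a, ha⟩ := by
  have h : DirectSum.decompose 𝒜 a = DirectSum.of (fun n ↦ 𝒜 n) n ⟨a, ha⟩ :=
    DirectSum.decompose_of_mem _ ha
  rw [dehomogenize, RingHom.comp_apply]
  exact (congrArg _ h).trans (DirectSum.toSemiring_of _ _ _ _ _)

/-- The homomorphism on `A_(f)` induced by a homomorphism `χ` from `A` with `χ f = 1`. -/
noncomputable def evalAway (χ : A →+* F) (h : χ f = 1) : Away 𝒜 f →+* F :=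
  (IsLocalization.Away.lift (S := Localization.Away f) f (g := χ) (h ▸ isUnit_one)).comp
    (algebraMap (Away 𝒜 f) (Localization.Away f))

theorem evalAway_frac (χ : A →+* F) (h : χ f = 1) (hf : f ∈ 𝒜 1) (n : ℕ) (a : 𝒜 n) :
    evalAway χ h (frac hf n a) = χ a := by
  rw [evalAway, RingHom.comp_apply, HomogeneousLocalization.algebraMap_apply]
  rw [val_frac, Localization.mk_eq_mk', IsLocalization.Away.lift, IsLocalization.lift_mk'_spec]
  simp [h]

theorem evalAway_comp_dehomogenize (χ : A →+* F) (h : χ f = 1) (hf : f ∈ 𝒜 1) :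
    (evalAway (𝒜 := 𝒜) χ h).comp (dehomogenize hf) = χ := by
  ext a
  induction a using DirectSum.Decomposition.inductionOn 𝒜 with
  | zero => simp
  | homogeneous a =>
    rw [RingHom.comp_apply, dehomogenize_of_mem hf a.2, evalAway_frac]
  | add a b ha hb => rw [map_add, ha, hb, map_add]

/-- Composing `ψ` with dehomogenization recovers `χ`. So the `F`-points of `D₊(f)` are the
homomorphisms from `A` normalized by `χ f = 1`. -/
theorem exists_evalAway_eq (hf : f ∈ 𝒜 1) (ψ : Away 𝒜 f →+* F) :
    ∃ (χ : A →+* F) (h : χ f = 1), evalAway χ h = ψ := by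
  have h : ψ.comp (dehomogenize hf) f = 1 := by
    rw [RingHom.comp_apply, dehomogenize_of_mem hf hf, ← map_one ψ]
    congr 1
    apply val_injective
    rw [val_frac, val_one]
    exact (congrArg (Localization.mk f) (Subtype.ext (pow_one f))).trans
      (Localization.mk_self (⟨f, Submonoid.mem_powers f⟩ : Submonoid.powers f))
  refine ⟨ψ.comp (dehomogenize hf), h, ?_⟩
  ext z
  obtain ⟨n, a, rfl⟩ := frac_surjective hf z
  rw [evalAway_frac, RingHom.comp_apply, dehomogenize_of_mem hf a.2]

/-- The point of `Proj` defined by a homomorphism `χ` with `χ f = 1`. -/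
noncomputable def point (hf : f ∈ 𝒜 1) (χ : A →+* F) (h : χ f = 1) : Spec (.of F) ⟶ Proj 𝒜 :=
  Spec.map (CommRingCat.ofHom (evalAway χ h)) ≫ Proj.awayι 𝒜 f hf one_pos

theorem point_injective (hf : f ∈ 𝒜 1) {χ χ' : A →+* F} {h : χ f = 1} {h' : χ' f = 1}
    (e : point hf χ h = point hf χ' h') : χ = χ' := by
  have := CommRingCat.hom_ext_iff.mp (Spec.map_injective ((cancel_mono _).mp e))
  rw [← evalAway_comp_dehomogenize χ h hf, ← evalAway_comp_dehomogenize χ' h' hf]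
  exact congrArg (RingHom.comp · (dehomogenize hf)) this

theorem exists_point_eq (hf : f ∈ 𝒜 1) (x : Spec (.of F) ⟶ Proj 𝒜)
    (hx : x default ∈ Proj.basicOpen 𝒜 f) :
    ∃ (χ : A →+* F) (h : χ f = 1), point hf χ h = x := by
  have hr : Set.range x ⊆ Set.range (Proj.awayι 𝒜 f hf one_pos) := by
    rintro _ ⟨p, rfl⟩
    rw [Subsingleton.elim p default]
    rw [← Proj.opensRange_awayι 𝒜 f hf one_pos] at hx
    exact hx
  let y := IsOpenImmersion.lift (Proj.awayι 𝒜 f hf one_pos) x hr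
  obtain ⟨χ, h, hχ⟩ := exists_evalAway_eq hf (Spec.preimage y).hom
  refine ⟨χ, h, ?_⟩
  rw [point, hχ, CommRingCat.ofHom_hom, Spec.map_preimage]
  exact IsOpenImmersion.lift_fac _ _ _

theorem point_mem_basicOpen (hf : f ∈ 𝒜 1) (χ : A →+* F) (h : χ f = 1) (hg : g ∈ 𝒜 1) :
    point hf χ h default ∈ Proj.basicOpen 𝒜 g ↔ χ g ≠ 0 := by
  have e : evalAway χ h (Away.isLocalizationElem hf hg) = χ g := by
    have hg' : g ^ 1 ∈ 𝒜 1 := by rwa [pow_one]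
    have : Away.isLocalizationElem hf hg = frac hf 1 ⟨g ^ 1, hg'⟩ := val_injective _ rfl
    rw [this, evalAway_frac]
    exact congrArg χ (pow_one g)
  have h₁ (p : PrimeSpectrum F) (z : Away 𝒜 f) :
      PrimeSpectrum.comap (evalAway χ h) p ∈ PrimeSpectrum.basicOpen z ↔
        evalAway χ h z ≠ 0 := by
    change evalAway χ h z ∉ p.asIdeal ↔ _
    rw [Ideal.eq_bot_of_prime p.asIdeal, Ideal.mem_bot]
  change Spec.map (CommRingCat.ofHom (evalAway χ h)) default ∈
    Proj.awayι 𝒜 f hf one_pos ⁻¹ᵁ Proj.basicOpen 𝒜 g ↔ _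
  rw [Proj.awayι_preimage_basicOpen 𝒜 hf one_pos hg one_pos, ← e]
  exact h₁ _ _

end ProjPoint

/-! ### Points of projective Weierstrass schemes with values in a field -/

namespace WeierstrassCurve

variable {R F : Type} [CommRing R] [Field F] (W : WeierstrassCurve R)

/-- The class of a coordinate in the homogeneous coordinate ring. -/
noncomputable def coord (i : Fin 3) : W.HomogCoordRing :=
  Ideal.Quotient.mk _ (MvPolynomial.X i)

theorem coord_mem (i : Fin 3) : W.coord i ∈ W.homogCoordGrading 1 :=
  W.mk_mem_homogCoordGrading (MvPolynomial.isHomogeneous_X R i)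

/-- The coordinates have degree one and generate the ring over its degree zero part. -/
theorem iSup_basicOpen_coord :
    ⨆ i, Proj.basicOpen W.homogCoordGrading (W.coord i) = ⊤ := by
  refine Proj.iSup_basicOpen_eq_top' _ _ (fun i ↦ ⟨1, W.coord_mem i⟩) ?_
  rw [eq_top_iff]
  rintro a -
  obtain ⟨P, rfl⟩ := Ideal.Quotient.mk_surjective a
  induction P using MvPolynomial.induction_on with
  | C r =>
    exact Subalgebra.algebraMap_mem _ (algebraMap R (W.homogCoordGrading 0) r)
  | add p q hp hq => rw [map_add]; exact add_mem hp hq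
  | mul_X p i hp =>
    rw [map_mul]
    exact mul_mem hp (Algebra.subset_adjoin ⟨i, rfl⟩)

variable [Subsingleton (R →+* F)] (φ : R →+* F)

omit [Subsingleton (R →+* F)] in
theorem eval₂_projective_polynomial (v : Fin 3 → F) :
    MvPolynomial.eval₂ φ v W.toProjective.polynomial =
      MvPolynomial.eval v (W.map φ).toProjective.polynomial := by
  rw [toProjective_map_polynomial, MvPolynomial.eval_map]

/-- As `R` has only one homomorphism to `F`, `χ` restricts to `φ` on constants. Absolute morphisms
from `Spec F` therefore see exactly the reduced curve `W.map φ`. -/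
theorem equation_coord (χ : W.HomogCoordRing →+* F) :
    (W.map φ).toProjective.Equation (fun i ↦ χ (W.coord i)) := by
  have h : χ.comp (Ideal.Quotient.mk _) = MvPolynomial.eval₂Hom φ (fun i ↦ χ (W.coord i)) := by
    refine MvPolynomial.ringHom_ext' (Subsingleton.elim _ _) fun i ↦ ?_
    simp [coord]
  have h' := DFunLike.congr_fun h W.toProjective.polynomial
  rw [Projective.Equation, ← eval₂_projective_polynomial]
  rw [RingHom.comp_apply, Ideal.Quotient.eq_zero_iff_mem.mpr (Ideal.mem_span_singleton_self _),
    map_zero] at h'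
  exact h'.symm

omit [Subsingleton (R →+* F)] in
theorem exists_ringHom_coord {v : Fin 3 → F} (hv : (W.map φ).toProjective.Equation v) :
    ∃ χ : W.HomogCoordRing →+* F, ∀ i, χ (W.coord i) = v i := by
  refine ⟨Ideal.Quotient.lift _ (MvPolynomial.eval₂Hom φ v) fun a ha ↦ ?_, fun i ↦ ?_⟩
  · obtain ⟨b, rfl⟩ := Ideal.mem_span_singleton.mp ha
    rw [map_mul]
    change MvPolynomial.eval₂ φ v _ * _ = 0
    rw [eval₂_projective_polynomial, hv, zero_mul]
  · simp [coord]

theorem ringHom_ext_coord {χ χ' : W.HomogCoordRing →+* F}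
    (h : ∀ i, χ (W.coord i) = χ' (W.coord i)) : χ = χ' :=
  Ideal.Quotient.ringHom_ext (MvPolynomial.ringHom_ext' (Subsingleton.elim _ _) h)

open ProjPoint

/-- The points of the affine chart `Z ≠ 0` are the solutions of the affine Weierstrass equation. -/
noncomputable def affinePointsEquiv :
    {p : F × F // (W.map φ).toAffine.Equation p.1 p.2} ≃
      {x : Spec (.of F) ⟶ W.projScheme //
        x default ∈ Proj.basicOpen W.homogCoordGrading (W.coord 2)} := by
  have hp (p : {p : F × F // (W.map φ).toAffine.Equation p.1 p.2}) :=
    W.exists_ringHom_coord φ ((Projective.equation_some p.1.1 p.1.2).mpr p.2)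
  choose χ hχ using hp
  have h1 (p) : χ p (W.coord 2) = 1 := hχ p 2
  refine Equiv.ofBijective (fun p ↦ ⟨point (W.coord_mem 2) (χ p) (h1 p),
    (point_mem_basicOpen _ _ _ (W.coord_mem 2)).mpr (by rw [h1]; exact one_ne_zero)⟩) ⟨?_, ?_⟩
  · intro p q hpq
    have e := point_injective _ (congrArg Subtype.val hpq)
    refine Subtype.ext (Prod.ext ?_ ?_)
    · exact (hχ p 0).symm.trans ((congrArg (· (W.coord 0)) e).trans (hχ q 0))
    · exact (hχ p 1).symm.trans ((congrArg (· (W.coord 1)) e).trans (hχ q 1))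
  · rintro ⟨x, hx⟩
    obtain ⟨χ', h', rfl⟩ := exists_point_eq (W.coord_mem 2) x hx
    have heq := W.equation_coord φ χ'
    have hv : (fun i ↦ χ' (W.coord i)) = ![χ' (W.coord 0), χ' (W.coord 1), 1] := by
      ext i
      fin_cases i
      · rfl
      · rfl
      · exact h'
    rw [hv] at heq
    refine ⟨⟨(χ' (W.coord 0), χ' (W.coord 1)), (Projective.equation_some _ _).mp heq⟩, ?_⟩
    apply Subtype.ext
    change point _ _ _ = point _ _ _
    congr 1
    refine W.ringHom_ext_coord fun i ↦ (hχ _ i).trans ?_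
    fin_cases i
    · rfl
    · rfl
    · exact h'.symm

include φ in
-- Setting `Z = 0` in the cubic leaves `X³ = 0`, so `[0 : 1 : 0]` is the only such point.
theorem card_points_at_infinity :
    Nat.card {x : Spec (.of F) ⟶ W.projScheme //
      x default ∉ Proj.basicOpen W.homogCoordGrading (W.coord 2)} = 1 := by
  obtain ⟨χ, hχ⟩ := W.exists_ringHom_coord φ (v := ![0, 1, 0])
    ((Projective.equation_iff _).mpr (by simp))
  have h1 : χ (W.coord 1) = 1 := hχ 1
  have h2 : χ (W.coord 2) = 0 := hχ 2
  have hmem : point (W.coord_mem 1) χ h1 default ∉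
      Proj.basicOpen W.homogCoordGrading (W.coord 2) := 
    fun h ↦ (point_mem_basicOpen _ _ _ (W.coord_mem 2)).mp h h2
  refine Nat.card_eq_one_iff_exists.mpr ⟨⟨_, hmem⟩, ?_⟩
  rintro ⟨x, hx⟩
  apply Subtype.ext
  change x = _
  obtain ⟨i, hi⟩ := TopologicalSpace.Opens.mem_iSup.mp
    (W.iSup_basicOpen_coord.ge (Set.mem_univ (x default)))
  obtain ⟨χ', h', rfl⟩ := exists_point_eq (W.coord_mem i) x hi
  replace hx : χ' (W.coord 2) = 0 :=
    not_ne_iff.mp fun h ↦ hx ((point_mem_basicOpen _ _ _ (W.coord_mem 2)).mpr h)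
  have heq := (Projective.equation_iff _).mp (W.equation_coord φ χ')
  simp only [hx, mul_zero, add_zero, ne_eq, OfNat.ofNat_ne_zero, not_false_eq_true,
    zero_pow] at heq
  have h0 : χ' (W.coord 0) = 0 := by simpa using heq.symm
  fin_cases i
  · exact absurd (h0.symm.trans h') zero_ne_one
  · have : χ' = χ := by
      refine W.ringHom_ext_coord fun i ↦ ?_
      rw [hχ]
      fin_cases i
      · exact h0
      · exact h'
      · exact hx
    subst this
    rfl
  · exact absurd (hx.symm.trans h') zero_ne_one

theorem card_points [Finite F] :
    Nat.card (Spec (.of F) ⟶ W.projScheme) =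
      Nat.card {p : F × F // (W.map φ).toAffine.Equation p.1 p.2} + 1 := by
  classical
  have h1 := W.card_points_at_infinity φ
  have : Finite {x : Spec (.of F) ⟶ W.projScheme //
      x default ∉ Proj.basicOpen W.homogCoordGrading (W.coord 2)} :=
    Nat.finite_of_card_ne_zero (by rw [h1]; exact one_ne_zero)
  have : Finite {x : Spec (.of F) ⟶ W.projScheme //
      x default ∈ Proj.basicOpen W.homogCoordGrading (W.coord 2)} :=
    Finite.of_equiv _ (W.affinePointsEquiv φ)
  rw [← Nat.card_congr (Equiv.sumCompl fun x : Spec (.of F) ⟶ W.projScheme ↦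
    x default ∈ Proj.basicOpen W.homogCoordGrading (W.coord 2)), Nat.card_sum, h1,
    Nat.card_congr (W.affinePointsEquiv φ)]

end WeierstrassCurve

/-! ### The Hasse bound for models of an elliptic curve over `ℚ` -/

instance ZInv.locallyOfFiniteType_specZInv (T : Finset Nat.Primes) :
    LocallyOfFiniteType (SpreadOut.specZInv T) :=
  (HasRingHomProperty.Spec_iff (P := @LocallyOfFiniteType)).mpr
    (RingHom.finiteType_algebraMap.mpr inferInstance)

namespace WeierstrassCurve

/-- An elliptic curve over `ℚ` has a Weierstrass model with good reduction outside a finite set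
of primes. -/
theorem exists_map_eq (E : WeierstrassCurve ℚ) [E.IsElliptic] :
    ∃ (T : Finset Nat.Primes) (W : WeierstrassCurve (ZInv T)),
      W.map (algebraMap (ZInv T) ℚ) = E ∧ W.IsElliptic := by
  classical
  choose T hT using ZInv.exists_mem
  -- Including `Δ⁻¹` makes the discriminant a unit, so reductions away from `U` are elliptic.
  let U : Finset Nat.Primes := ([E.a₁, E.a₂, E.a₃, E.a₄, E.a₆, E.Δ⁻¹].map T).foldr (· ∪ ·) ∅
  have hU {r : ℚ} (hr : r ∈ [E.a₁, E.a₂, E.a₃, E.a₄, E.a₆, E.Δ⁻¹]) : r ∈ ZInv U := by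
    refine ZInv.mono ?_ (hT r)
    simp only [List.mem_cons, List.not_mem_nil, or_false] at hr
    simp only [U, List.map_cons, List.map_nil, List.foldr_cons, List.foldr_nil]
    intro p hp
    simp only [Finset.mem_union]
    rcases hr with rfl | rfl | rfl | rfl | rfl | rfl <;> tauto
  let W : WeierstrassCurve (ZInv U) := ⟨⟨E.a₁, hU (by simp)⟩, ⟨E.a₂, hU (by simp)⟩,
    ⟨E.a₃, hU (by simp)⟩, ⟨E.a₄, hU (by simp)⟩, ⟨E.a₆, hU (by simp)⟩⟩
  have hW : W.map (algebraMap (ZInv U) ℚ) = E := rfl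
  refine ⟨U, W, hW, ⟨IsUnit.of_mul_eq_one ⟨E.Δ⁻¹, hU (by simp)⟩ (Subtype.ext ?_)⟩⟩
  have hΔ : ((W.Δ : ZInv U) : ℚ) = E.Δ := (W.map_Δ (algebraMap (ZInv U) ℚ)).symm
  change ((W.Δ : ZInv U) : ℚ) * E.Δ⁻¹ = 1
  rw [hΔ, mul_inv_cancel₀ E.isUnit_Δ.ne_zero]

/-- An elliptic curve over `ℚ` has a model over `ℤ` whose points over almost all finite fields
satisfy the Hasse bound. -/
theorem exists_model_sq_card_sub_le (E : WeierstrassCurve ℚ) [E.IsElliptic] :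
    ∃ (𝒴 : Scheme.{0}) (ρ : 𝒴 ⟶ Spec (.of ℤ)) (j : E.projScheme ⟶ 𝒴),
      IsSeparated ρ ∧ LocallyOfFiniteType ρ ∧ QuasiCompact ρ ∧
      IsPullback j E.projSchemeToSpec ρ SpreadOut.specQ ∧
      ∃ T : Finset Nat.Primes, ∀ (F : Type) [Field F] [Finite F],
        (∀ p ∈ T, ((p : ℕ) : F) ≠ 0) →
        ((Nat.card (Spec (.of F) ⟶ 𝒴) : ℤ) - Nat.card F - 1) ^ 2 ≤ 4 * Nat.card F := by
  classical
  obtain ⟨T, W, rfl, hW⟩ := E.exists_map_eq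
  obtain ⟨j, hj⟩ := W.exists_isPullback_projScheme (K := ℚ)
  refine ⟨_, W.projSchemeToSpec ≫ SpreadOut.specZInv T, j, inferInstance, inferInstance,
    -- The prime `2` is discarded because Hasse's bound is proved in odd characteristic only.
    inferInstance, SpreadOut.isPullback_comp_specZInv hj, T ∪ {⟨2, Nat.prime_two⟩},
    fun F _ _ hF ↦ ?_⟩
  obtain ⟨φ⟩ := ZInv.nonempty_ringHom (S := T) (F := F)
    fun p hp ↦ hF p (Finset.mem_union_left _ hp)
  have h2 : ringChar F ≠ 2 := by
    intro h
    refine hF ⟨2, Nat.prime_two⟩ (Finset.mem_union_right _ (Finset.mem_singleton_self _)) ?_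
    have h' := ringChar.Nat.cast_ringChar (R := F)
    rwa [h] at h'
  have := (W.map φ).sq_card_equation_sub_le h2
  rw [W.card_points φ]
  push_cast
  rw [add_sub_right_comm, add_sub_cancel_right]
  exact this

end WeierstrassCurve

/-! ### Point counts of arbitrary models over `ℤ` -/

namespace SpreadOut

variable {E : WeierstrassCurve ℚ} [E.IsElliptic] {𝒳 𝒴 X : Scheme.{0}} {s : X ⟶ Spec (.of ℚ)}
  {π : 𝒳 ⟶ Spec (.of ℤ)} {ρ : 𝒴 ⟶ Spec (.of ℤ)}

theorem galoisField_natCast_ne_zero {T : Finset Nat.Primes} {p : Nat.Primes} (hp : p ∉ T) (m : ℕ) :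
    haveI : Fact (p : ℕ).Prime := ⟨p.2⟩
    ∀ r ∈ T, ((r : ℕ) : GaloisField p m) ≠ 0 := by
  have : Fact (p : ℕ).Prime := ⟨p.2⟩
  intro r hr h
  rw [CharP.cast_eq_zero_iff (GaloisField p m) p, Nat.prime_dvd_prime_iff_eq p.2 r.2] at h
  exact hp (Subtype.ext h ▸ hr)

/-- Two models of the same scheme have the same number of points over almost all finite fields. -/
theorem exists_pointCount_eq [QuasiCompact π] [IsSeparated π] [LocallyOfFiniteType π]
    [QuasiCompact ρ] [IsSeparated ρ] [LocallyOfFiniteType ρ] {i : X ⟶ 𝒳} {j : X ⟶ 𝒴}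
    (hi : IsPullback i s π specQ) (hj : IsPullback j s ρ specQ) :
    ∃ T : Finset Nat.Primes, ∀ q ∈ primePowersAway T, pointCount 𝒳 q = pointCount 𝒴 q := by
  obtain ⟨T, hT⟩ := nonempty_equiv_specPoints hi hj
  refine ⟨T, ?_⟩
  rintro _ ⟨p, hp, m, hm, rfl⟩
  have : Fact (p : ℕ).Prime := ⟨p.2⟩
  obtain ⟨e⟩ := hT (GaloisField p m) (galoisField_natCast_ne_zero hp m)
  rw [← GaloisField.card p m (Nat.one_le_iff_ne_zero.mp hm), pointCount_eq, pointCount_eq,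
    Nat.card_congr e]

/-- The Hasse bound for the points of a model of an elliptic curve over `ℚ`. -/
theorem exists_sq_pointCount_sub_le [QuasiCompact π] [IsSeparated π] [LocallyOfFiniteType π]
    {i : E.projScheme ⟶ 𝒳} (hi : IsPullback i E.projSchemeToSpec π specQ) :
    ∃ T : Finset Nat.Primes, ∀ q ∈ primePowersAway T,
      ((pointCount 𝒳 q : ℤ) - q - 1) ^ 2 ≤ 4 * q := by
  classical
  obtain ⟨𝒴, ρ, j, _, _, _, hj, T, hT⟩ := E.exists_model_sq_card_sub_le
  obtain ⟨T', hT'⟩ := exists_pointCount_eq hi hj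
  refine ⟨T ∪ T', ?_⟩
  rintro _ ⟨p, hp, m, hm, rfl⟩
  rw [Finset.mem_union, not_or] at hp
  have : Fact (p : ℕ).Prime := ⟨p.2⟩
  rw [hT' _ ⟨p, hp.2, m, hm, rfl⟩]
  have h := hT (GaloisField p m) (galoisField_natCast_ne_zero hp.1 m)
  rw [← pointCount_eq, GaloisField.card p m (Nat.one_le_iff_ne_zero.mp hm)] at h
  exact h

end SpreadOut

/-! ### Uniqueness of ceiling and floor Puiseux polynomials -/

namespace Puiseux

open Polynomial in
theorem aeval_root_mul {R : Type*} [CommRing R] (m n : ℕ+) (Q : R[X]) :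
    aeval (root R (m * n)) (Q.comp (X ^ (m : ℕ))) = aeval (root R n) Q := by
  have h : root R (m * n) ^ (m : ℕ) = root R n := by
    rw [root, root, ← map_pow, Ideal.Quotient.eq]
    exact Ideal.subset_span ⟨m, n, rfl⟩
  rw [aeval_comp, map_pow, aeval_X, h]

open Polynomial in
/-- Every Puiseux polynomial is a polynomial in some `t^{1/n}`. -/
theorem exists_aeval_root_eq {R : Type*} [CommRing R] (f : Puiseux R) :
    ∃ (n : ℕ+) (Q : R[X]), aeval (root R n) Q = f := by
  obtain ⟨P, rfl⟩ := Ideal.Quotient.mk_surjective f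
  induction P using MvPolynomial.induction_on with
  | C r => exact ⟨1, C r, aeval_C _ _⟩
  | add p q hp hq =>
    obtain ⟨m, P, hP⟩ := hp
    obtain ⟨n, Q, hQ⟩ := hq
    refine ⟨n * m, P.comp (X ^ (n : ℕ)) + Q.comp (X ^ (m : ℕ)), ?_⟩
    rw [map_add, aeval_root_mul, mul_comm n m, aeval_root_mul, hP, hQ, map_add]
  | mul_X p m hp =>
    obtain ⟨n, P, hP⟩ := hp
    refine ⟨m * n, P.comp (X ^ (m : ℕ)) * X.comp (X ^ (n : ℕ)), ?_⟩
    rw [map_mul, aeval_root_mul, mul_comm m n, aeval_root_mul, hP, aeval_X, map_mul]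
    rfl

theorem eval_root (x : ℝ≥0) (n : ℕ+) : eval x (root ℝ n) = (x : ℝ) ^ (1 / (n : ℝ)) :=
  (Ideal.Quotient.lift_mk _ _ _).trans (MvPolynomial.eval_X _)

theorem eval_aeval_root (x : ℝ≥0) (n : ℕ+) (Q : Polynomial ℝ) :
    eval x (Polynomial.aeval (root ℝ n) Q) = Q.eval ((x : ℝ) ^ (1 / (n : ℝ))) := by
  -- The identity is the only ring endomorphism of `ℝ`.
  have h : (eval x).comp (algebraMap ℝ (Puiseux ℝ)) = RingHom.id ℝ := Subsingleton.elim _ _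
  rw [Polynomial.aeval_def, Polynomial.hom_eval₂, h, eval_root, Polynomial.eval₂_id]

open Filter in
/-- A Puiseux polynomial that takes values less than `1` at infinitely many integers is constant
or tends to `-∞`. -/
theorem leadingCoeff_neg_or {n : ℕ+} {Q : Polynomial ℝ}
    (h : {k : ℕ | Q.eval ((k : ℝ) ^ (1 / (n : ℝ))) < 1}.Infinite) :
    Q.degree ≤ 0 ∨ Q.leadingCoeff < 0 := by
  by_contra! H
  have hn : 0 < 1 / (n : ℝ) := by
    have : (0 : ℝ) < n := by exact_mod_cast n.pos
    positivity
  have ht : Tendsto (fun k : ℕ ↦ Q.eval ((k : ℝ) ^ (1 / (n : ℝ)))) atTop atTop :=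
    (Q.tendsto_atTop_of_leadingCoeff_nonneg H.1 H.2).comp
      ((tendsto_rpow_atTop hn).comp tendsto_natCast_atTop_atTop)
  obtain ⟨k, hk, hk'⟩ := ((Nat.frequently_atTop_iff_infinite.mpr h).and_eventually
    (ht.eventually_ge_atTop 1)).exists
  exact absurd hk' (not_le.mpr hk)

end Puiseux

/-- Whenever `⌊f(k)⌋ = A_k`, one has `f(k) < A_k + 1 ≤ g(k) + 1`. -/
theorem IsCeilingPuiseux.infinite_sub_lt_one {P : Set ℕ} {A : ℕ → ℤ} {f g : Puiseux ℝ}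
    (hf : IsCeilingPuiseux P A f) (hg : IsCeilingPuiseux P A g) :
    {k : ℕ | Puiseux.eval k f - Puiseux.eval k g < 1}.Infinite := by
  refine hf.infinite_floor_eq.mono ?_
  rintro k ⟨hk, hfk⟩
  have h₁ := Int.lt_floor_add_one (Puiseux.eval k f)
  rw [hfk] at h₁
  have h₂ := hg.le_eval k hk
  rw [Set.mem_ofPred_eq]
  linarith

/-- The ceiling Puiseux polynomial of a sequence is unique. -/
theorem IsCeilingPuiseux.unique {P : Set ℕ} {A : ℕ → ℤ} {f g : Puiseux ℝ}
    (hf : IsCeilingPuiseux P A f) (hg : IsCeilingPuiseux P A g) : f = g := by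
  obtain ⟨n, Q, hQ⟩ := Puiseux.exists_aeval_root_eq (f - g)
  have hev (x : ℝ≥0) : Q.eval ((x : ℝ) ^ (1 / (n : ℝ))) = Puiseux.eval x f - Puiseux.eval x g := by
    rw [← Puiseux.eval_aeval_root, hQ, map_sub]
  have h₁ : {k : ℕ | Q.eval ((k : ℝ) ^ (1 / (n : ℝ))) < 1}.Infinite := by
    convert hf.infinite_sub_lt_one hg using 4 with k
    exact hev k
  have h₂ : {k : ℕ | (-Q).eval ((k : ℝ) ^ (1 / (n : ℝ))) < 1}.Infinite := by
    convert hg.infinite_sub_lt_one hf using 4 with k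
    rw [Polynomial.eval_neg, ← neg_sub, ← hev k]
    rfl
  have hdeg : Q.degree ≤ 0 := by
    rcases Puiseux.leadingCoeff_neg_or h₁ with h | h
    · exact h
    rcases Puiseux.leadingCoeff_neg_or h₂ with h' | h'
    · rwa [Polynomial.degree_neg] at h'
    · rw [Polynomial.leadingCoeff_neg] at h'
      linarith
  rw [Polynomial.eq_C_of_degree_le_zero hdeg] at hQ h₁ h₂ hev
  set c := Q.coeff 0
  simp only [Polynomial.eval_C, Polynomial.eval_neg] at h₁ h₂ hev
  obtain ⟨_, hc₁⟩ := h₁.nonempty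
  obtain ⟨_, hc₂⟩ := h₂.nonempty
  obtain ⟨a, ha⟩ := hf.eval_one
  obtain ⟨b, hb⟩ := hg.eval_one
  have hc := hev 1
  rw [ha, hb, ← Int.cast_sub] at hc
  rw [Set.mem_ofPred_eq, hc] at hc₁ hc₂
  -- The constant is the integer `f(1) - g(1)` and lies strictly between `-1` and `1`.
  have hab : a - b = 0 := by
    have h₃ : a - b < 1 := by exact_mod_cast hc₁
    have h₄ : -(a - b) < 1 := by exact_mod_cast hc₂
    omega
  rw [← sub_eq_zero, ← hQ, hc, hab]
  simp

/-- Negation exchanges floors and ceilings, so uniqueness transfers from one case to the other. -/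
theorem isFloorPuiseux_iff {P : Set ℕ} {A : ℕ → ℤ} {f : Puiseux ℝ} :
    IsFloorPuiseux P A f ↔ IsCeilingPuiseux P (fun n ↦ -A n) (-f) := by
  have h (x : ℝ≥0) : Puiseux.eval x (-f) = -Puiseux.eval x f := map_neg _ _
  constructor
  · rintro ⟨h₁, h₂, k, h₃⟩
    refine ⟨fun n hn ↦ ?_, ?_, -k, ?_⟩
    · rw [h]; push_cast; linarith [h₁ n hn]
    · simpa only [h, Int.floor_neg, neg_inj] using h₂
    · rw [h, h₃]; push_cast; rfl
  · rintro ⟨h₁, h₂, k, h₃⟩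
    refine ⟨fun n hn ↦ ?_, ?_, -k, ?_⟩
    · have := h₁ n hn
      rw [h] at this
      push_cast at this
      linarith
    · simpa only [h, Int.floor_neg, neg_inj] using h₂
    · rw [h] at h₃
      rw [← neg_neg (Puiseux.eval 1 f), h₃]; push_cast; rfl

/-- The floor Puiseux polynomial of a sequence is unique. -/
theorem IsFloorPuiseux.unique {P : Set ℕ} {A : ℕ → ℤ} {f g : Puiseux ℝ}
    (hf : IsFloorPuiseux P A f) (hg : IsFloorPuiseux P A g) : f = g :=
  neg_injective ((isFloorPuiseux_iff.mp hf).unique (isFloorPuiseux_iff.mp hg))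

/-! ### Champion and trailing primes -/

theorem Puiseux.eval_root_one_two (q : ℕ) :
    Puiseux.eval q (Puiseux.root ℝ 1) = q ∧ Puiseux.eval q (Puiseux.root ℝ 2) = √(q : ℝ) := by
  constructor
  · rw [Puiseux.eval_root]
    simp
  · rw [Puiseux.eval_root, Real.sqrt_eq_rpow]
    norm_num

theorem Puiseux.eval_add_two_mul_root (q : ℕ) :
    Puiseux.eval q (Puiseux.root ℝ 1 + 2 * Puiseux.root ℝ 2 + 1) = q + 2 * √(q : ℝ) + 1 := by
  rw [map_add, map_add, map_mul, map_ofNat, map_one, (Puiseux.eval_root_one_two q).1,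
    (Puiseux.eval_root_one_two q).2]

theorem Puiseux.eval_sub_two_mul_root (q : ℕ) :
    Puiseux.eval q (Puiseux.root ℝ 1 - 2 * Puiseux.root ℝ 2 + 1) = q - 2 * √(q : ℝ) + 1 := by
  rw [map_add, map_sub, map_mul, map_ofNat, map_one, (Puiseux.eval_root_one_two q).1,
    (Puiseux.eval_root_one_two q).2]

theorem primePowersAway_anti {S T : Finset Nat.Primes} (h : S ⊆ T) :
    primePowersAway T ⊆ primePowersAway S :=
  fun _ ⟨p, hp, hn⟩ ↦ ⟨p, fun hpS ↦ hp (h hpS), hn⟩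

theorem primesAway_subset_primePowersAway (S : Finset Nat.Primes) :
    primesAway S ⊆ primePowersAway S :=
  fun _ ⟨p, hp, hn⟩ ↦ ⟨p, hp, 1, le_rfl, hn.trans (pow_one _).symm⟩

theorem infinite_image_primes_diff {C : Set Nat.Primes} (hC : C.Infinite)
    (S : Finset Nat.Primes) :
    ((fun p : Nat.Primes ↦ (p : ℕ)) '' (C \ S)).Infinite :=
  (hC.sdiff S.finite_toSet).image (Subtype.val_injective.injOn)

theorem abs_sub_le_two_mul_sqrt {N q : ℕ} (h : ((N : ℤ) - q - 1) ^ 2 ≤ 4 * q) :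
    |(N : ℝ) - q - 1| ≤ 2 * √(q : ℝ) := by
  refine abs_le_of_sq_le_sq ?_ (by positivity)
  rw [mul_pow, Real.sq_sqrt (Nat.cast_nonneg q)]
  norm_num
  exact_mod_cast h

section

variable {E : WeierstrassCurve ℚ} [E.IsElliptic] {S : Finset Nat.Primes} {𝓔 𝒳 : Scheme.{0}}
  {π : 𝓔 ⟶ Spec (.of (ZInv S))} [IsProper π] {ρ : 𝒳 ⟶ Spec (.of ℤ)}
  [IsSeparated ρ] [LocallyOfFiniteType ρ] [QuasiCompact ρ]

/-- For almost all prime powers `q`, the number of points of a model over `ℤ` satisfies the Hasse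
bound and agrees with that of the given model over `ℤ[S⁻¹]`. -/
theorem exists_abs_sub_le_and_eq (hE : IsGenericFiber π E.projSchemeToSpec)
    (hρ : IsGenericFiber ρ E.projSchemeToSpec) :
    ∃ T : Finset Nat.Primes, ∀ q ∈ primePowersAway T,
      |(pointCount 𝒳 q : ℝ) - q - 1| ≤ 2 * √(q : ℝ) ∧ pointCount 𝒳 q = pointCount 𝓔 q := by
  classical
  obtain ⟨i, hi⟩ := SpreadOut.exists_isPullback_of_isGenericFiber hE
  obtain ⟨j, hj⟩ := SpreadOut.exists_isPullback_of_isGenericFiber hρ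
  obtain ⟨T₁, h₁⟩ := SpreadOut.exists_sq_pointCount_sub_le hj
  obtain ⟨T₂, h₂⟩ := SpreadOut.exists_pointCount_eq hj (SpreadOut.isPullback_comp_specZInv hi)
  exact ⟨T₁ ∪ T₂, fun q hq ↦
    ⟨abs_sub_le_two_mul_sqrt (h₁ q (primePowersAway_anti Finset.subset_union_left hq)),
    h₂ q (primePowersAway_anti Finset.subset_union_right hq)⟩⟩

/-- Allowing any `P` between the primes and the prime powers treats both polynomials at once: the
bound holds at all prime powers, and the champion primes already lie in the smaller set. -/
theorem exists_isCeilingPuiseux (hE : IsGenericFiber π E.projSchemeToSpec)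
    (hC : (championPrimes S 𝓔).Infinite) (hρ : IsGenericFiber ρ E.projSchemeToSpec) :
    ∃ S₀ : Finset Nat.Primes, ∀ S : Finset Nat.Primes, S₀ ⊆ S → ∀ P : Set ℕ,
      primesAway S ⊆ P → P ⊆ primePowersAway S →
      IsCeilingPuiseux P (fun q ↦ pointCount 𝒳 q)
        (Puiseux.root ℝ 1 + 2 * Puiseux.root ℝ 2 + 1) := by
  obtain ⟨T, hT⟩ := exists_abs_sub_le_and_eq hE hρ
  refine ⟨T, fun U hU P hP hP' ↦ ⟨fun q hq ↦ ?_, ?_, 4, ?_⟩⟩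
  · have := (abs_le.mp (hT q (primePowersAway_anti hU (hP' hq))).1).2
    rw [Puiseux.eval_add_two_mul_root]
    push_cast
    linarith
  -- Discarding the finite set `U` leaves infinitely many champion primes, and at each of them the
  -- integer `p + 1` comes out of the floor.
  · refine (infinite_image_primes_diff hC U).mono ?_
    rintro _ ⟨p, ⟨⟨-, hp⟩, hpU⟩, rfl⟩
    have hq : (p : ℕ) ∈ P := hP ⟨p, hpU, rfl⟩
    refine ⟨hq, ?_⟩
    rw [(hT p (primePowersAway_anti hU (hP' hq))).2, hp, Puiseux.eval_add_two_mul_root]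
    rw [← Int.cast_natCast (p : ℕ), add_right_comm, ← Int.cast_one, ← Int.cast_add,
      Int.floor_intCast_add, Int.cast_natCast]
  · have := Puiseux.eval_add_two_mul_root 1
    rw [Nat.cast_one, Nat.cast_one, Real.sqrt_one] at this
    rw [this]
    norm_num

theorem exists_isFloorPuiseux (hE : IsGenericFiber π E.projSchemeToSpec)
    (hC : (trailingPrimes S 𝓔).Infinite) (hρ : IsGenericFiber ρ E.projSchemeToSpec) :
    ∃ S₀ : Finset Nat.Primes, ∀ S : Finset Nat.Primes, S₀ ⊆ S → ∀ P : Set ℕ,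
      primesAway S ⊆ P → P ⊆ primePowersAway S →
      IsFloorPuiseux P (fun q ↦ pointCount 𝒳 q)
        (Puiseux.root ℝ 1 - 2 * Puiseux.root ℝ 2 + 1) := by
  obtain ⟨T, hT⟩ := exists_abs_sub_le_and_eq hE hρ
  refine ⟨T, fun U hU P hP hP' ↦ ⟨fun q hq ↦ ?_, ?_, 0, ?_⟩⟩
  · have := (abs_le.mp (hT q (primePowersAway_anti hU (hP' hq))).1).1
    rw [Puiseux.eval_sub_two_mul_root]
    push_cast
    linarith
  · refine (infinite_image_primes_diff hC U).mono ?_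
    rintro _ ⟨p, ⟨⟨-, hp⟩, hpU⟩, rfl⟩
    have hq : (p : ℕ) ∈ P := hP ⟨p, hpU, rfl⟩
    refine ⟨hq, ?_⟩
    -- In this form the integer part leaves the ceiling, and `⌈-x⌉ = -⌊x⌋` gives the trailing count.
    have h : ((p : ℕ) : ℝ) - 2 * √((p : ℕ) : ℝ) + 1 =
        (((p : ℕ) + 1 : ℤ) : ℝ) + -(2 * √((p : ℕ) : ℝ)) := by
      push_cast
      ring
    rw [(hT p (primePowersAway_anti hU (hP' hq))).2, hp, Puiseux.eval_sub_two_mul_root, h,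
      Int.ceil_intCast_add, Int.ceil_neg, sub_eq_add_neg]
  · have := Puiseux.eval_sub_two_mul_root 1
    rw [Nat.cast_one, Nat.cast_one, Real.sqrt_one] at this
    rw [this]
    norm_num

end

/-- The defining properties quantify over all models, so uniqueness needs at least one to exist. -/
theorem WeierstrassCurve.exists_model (E : WeierstrassCurve ℚ) [E.IsElliptic] :
    ∃ (𝒴 : Scheme.{0}) (ρ : 𝒴 ⟶ Spec (.of ℤ)), IsSeparated ρ ∧ LocallyOfFiniteType ρ ∧
      QuasiCompact ρ ∧ IsGenericFiber ρ E.projSchemeToSpec := by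
  obtain ⟨𝒴, ρ, j, h₁, h₂, h₃, hj, -⟩ := E.exists_model_sq_card_sub_le
  exact ⟨𝒴, ρ, h₁, h₂, h₃, SpreadOut.isGenericFiber_of_isPullback hj⟩

theorem mainTheorem11 (E : WeierstrassCurve ℚ) [E.IsElliptic]
    (S : Finset Nat.Primes) (𝓔 : Scheme.{0}) (π : 𝓔 ⟶ Spec (.of (ZInv S)))
    [IsProper π] [Smooth π] (hE : IsGenericFiber π E.projSchemeToSpec) :
    ((championPrimes S 𝓔).Infinite →
      (∀ f : Puiseux ℝ, IsPrimeCeilingPuiseuxOf E.projSchemeToSpec f ↔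
        f = Puiseux.root ℝ 1 + 2 * Puiseux.root ℝ 2 + 1) ∧
      (∀ f : Puiseux ℝ, IsCeilingPuiseuxOf E.projSchemeToSpec f ↔
        f = Puiseux.root ℝ 1 + 2 * Puiseux.root ℝ 2 + 1)) ∧
    ((trailingPrimes S 𝓔).Infinite →
      (∀ f : Puiseux ℝ, IsPrimeFloorPuiseuxOf E.projSchemeToSpec f ↔
        f = Puiseux.root ℝ 1 - 2 * Puiseux.root ℝ 2 + 1) ∧
      (∀ f : Puiseux ℝ, IsFloorPuiseuxOf E.projSchemeToSpec f ↔
        f = Puiseux.root ℝ 1 - 2 * Puiseux.root ℝ 2 + 1)) := by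
  classical
  obtain ⟨𝒴, ρ, _, _, _, hρ⟩ := E.exists_model
  have hle := primesAway_subset_primePowersAway
  refine ⟨fun hC ↦ ?_, fun hC ↦ ?_⟩
  · obtain ⟨S₁, h₁⟩ := exists_isCeilingPuiseux hE hC hρ
    refine ⟨fun f ↦ ⟨fun hf ↦ ?_, ?_⟩, fun f ↦ ⟨fun hf ↦ ?_, ?_⟩⟩
    · obtain ⟨S₀, h₀⟩ := hf 𝒴 ρ hρ
      -- Enlarging the excluded set to `S₀ ∪ S₁` makes both polynomials ceiling polynomials of one
      -- and the same sequence.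
      exact (h₀ (S₀ ∪ S₁) Finset.subset_union_left).unique
        (h₁ (S₀ ∪ S₁) Finset.subset_union_right _ subset_rfl (hle _))
    · rintro rfl 𝒳 σ _ _ _ hσ
      obtain ⟨S₀, h₀⟩ := exists_isCeilingPuiseux hE hC hσ
      exact ⟨S₀, fun U hU ↦ h₀ U hU _ subset_rfl (hle _)⟩
    · obtain ⟨S₀, h₀⟩ := hf 𝒴 ρ hρ
      exact (h₀ (S₀ ∪ S₁) Finset.subset_union_left).unique
        (h₁ (S₀ ∪ S₁) Finset.subset_union_right _ (hle _) subset_rfl)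
    · rintro rfl 𝒳 σ _ _ _ hσ
      obtain ⟨S₀, h₀⟩ := exists_isCeilingPuiseux hE hC hσ
      exact ⟨S₀, fun U hU ↦ h₀ U hU _ (hle _) subset_rfl⟩
  · obtain ⟨S₁, h₁⟩ := exists_isFloorPuiseux hE hC hρ
    refine ⟨fun f ↦ ⟨fun hf ↦ ?_, ?_⟩, fun f ↦ ⟨fun hf ↦ ?_, ?_⟩⟩
    · obtain ⟨S₀, h₀⟩ := hf 𝒴 ρ hρ
      exact (h₀ (S₀ ∪ S₁) Finset.subset_union_left).unique
        (h₁ (S₀ ∪ S₁) Finset.subset_union_right _ subset_rfl (hle _))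
    · rintro rfl 𝒳 σ _ _ _ hσ
      obtain ⟨S₀, h₀⟩ := exists_isFloorPuiseux hE hC hσ
      exact ⟨S₀, fun U hU ↦ h₀ U hU _ subset_rfl (hle _)⟩
    · obtain ⟨S₀, h₀⟩ := hf 𝒴 ρ hρ
      exact (h₀ (S₀ ∪ S₁) Finset.subset_union_left).unique
        (h₁ (S₀ ∪ S₁) Finset.subset_union_right _ (hle _) subset_rfl)
    · rintro rfl 𝒳 σ _ _ _ hσ
      obtain ⟨S₀, h₀⟩ := exists_isFloorPuiseux hE hC hσ
      exact ⟨S₀, fun U hU ↦ h₀ U hU _ (hle _) subset_rfl⟩
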